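/- \textbf{Setting.} For $n\ge 0$ let $\mathcal P_n$ be the $n$-qubit Pauli group, i.e. the group of unitaries on $(\mathbb C^2)^{\otimes n}$ generated by the bit flips $X_j$, the phase flips $Z_j$ and $iI$; $\mathcal Z(\cdot)$ denotes the centralizer in $\mathcal P_n$, $\mathcal N(\cdot)$ the normalizer in $\mathcal P_{n+e}$, and operators are called independent if none of them lies in the group generated by the others and $iI$. An \emph{$n$-qubit entanglement-assisted code} $C=C(\mathcal H,\mathcal S,\mathcal G_0,\mathcal L_0,\mathcal T_0)$ with $e$ ebits consists of the following data. (1) A subgroup $\mathcal H\le\mathcal P_n$ generated by independent elements $\overline Z_1,\dots,\overline Z_e,\overline X_1,\dots,\overline X_e,W_1,\dots,W_s$, where $\overline Z_i$ and $\overline X_i$ anticommute for each $i$ and all other pairs commute. Put $\mathcal H_I=\langle W_1,\dots,W_s\rangle$ (the isotropic subgroup). (2) An Abelian subgroup $\mathcal S\le\mathcal P_{n+e}$ with $-I\notin\mathcal S$ that is generated by extensions $h\otimes b_h$ of the generators $h$ of $\mathcal H$ listed in (1), with $b_h\in\mathcal P_e$ acting on $e$ additional qubits held by Bob. Let $P$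 be the orthogonal projection onto the joint $+1$ eigenspace $C(\mathcal S)\subseteq(\mathbb C^2)^{\otimes(n+e)}$ of $\mathcal S$. (3) Sets $\mathcal G_0,\mathcal L_0\subseteq\mathcal P_{n+e}$ of gauge and logical operators, all of the form $g^{(n)}\otimes I$ with $g^{(n)}\in\mathcal P_n$, such that every element of $\mathcal G_0$ commutes with every element of $\mathcal L_0$, $\mathcal N(\mathcal S)=\langle\mathcal S,iI,\mathcal G_0,\mathcal L_0\rangle$, and the $*$-algebras with unit $P$ generated by $\mathcal G_0P$ and by $\mathcal L_0P$ are $*$-isomorphic to the full matrix algebras $M_{2^r}(\mathbb C)$ and $M_{2^k}(\mathbb C)$, respectively, for some $r,k\ge 0$. Put $\mathcal G_0^{(n)}=\{g^{(n)}: g^{(n)}\otimes I\in\mathcal G_0\}$. (4) A set $\mathcal T_0\subseteq\mathcal P_{n+e}$ with $I\in\mathcal T_0$ that is contained in a transversal of the cosets $g\,\mathcal N(\mathcal S)$ of $\mathcal N(\mathcal S)$ in $\mathcal P_{n+e}$. \textbf{Correctability.} Let $\mathcal A_L$ be the $*$-algebra with unit $P$ generated by $\mathcal L_0P$, let $\mathcal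 A=\sum_{T\in\mathcal T_0}T\mathcal A_LT^\dagger$, and let $Q$ be the orthogonal projection onto $\operatorname{span}\bigcup_{T\in\mathcal T_0}T\,C(\mathcal S)$. A set of errors $\{E_a\otimes I\}$ with $E_a\in\mathcal P_n$ is \emph{correctable} for $C$ if there is a quantum channel $\mathcal R$ on $(\mathbb C^2)^{\otimes(n+e)}$ such that for every quantum channel $\Phi$ with a Kraus representation whose operators are scalar multiples of the operators $E_a\otimes I$, $$Q\,(\mathcal R\circ\Phi)^\dagger(X)\,Q=Q\,X\,Q\qquad\text{for all }X\in\mathcal A,$$ where $(\mathcal R\circ\Phi)^\dagger$ is the dual (Heisenberg picture) map. \textbf{Theorem.} Let $C=C(\mathcal H,\mathcal S,\mathcal G_0,\mathcal L_0,\mathcal T_0)$ be an $n$-qubit entanglement-assisted code all of whose transversal operators act as the identity on Bob's qubits: $\mathcal T_0=\{T_i=T_i^{(n)}\otimes I\}_i$ with $T_i^{(n)}\in\mathcal P_n$, the $T_i$ being distinct. Then a set of errors $\{E_a\otimes I\}$ with $E_a\in\mathcal P_n$ is correctable for $C$ if and only if for all $a,b$, $$E_a^\dagger E_b\in\Big(\langle\mathcal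 H_I,\mathcal G_0^{(n)},iI\rangle\cup\big(\mathcal P_n\setminus\mathcal Z(\mathcal H)\big)\Big)\cap\Big(\mathcal P_n\setminus\bigcup_{i\ne j}T_i^{(n)}(T_j^{(n)})^{-1}\mathcal Z(\mathcal H)\Big).$$ -/

import Mathlib

open scoped Kronecker Matrix

set_option linter.unusedSectionVars false

noncomputable section

namespace EAOAQEC

/-! ### Qubit operators and the Pauli group -/

/-- Operators on the system of qubits labelled by `α`, as matrices in the computational basis. -/
abbrev Op (α : Type) := Matrix (α → Fin 2) (α → Fin 2) ℂ

/-- The Hilbert space of the system of qubits labelled by `α`. -/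
abbrev QubitSpace (α : Type) := EuclideanSpace ℂ (α → Fin 2)

/-- The tensor product of one single-qubit operator per qubit. -/
def siteTensor {α : Type} [Fintype α] (σ : α → Matrix (Fin 2) (Fin 2) ℂ) : Op α :=
  Matrix.of fun x y => ∏ j, σ j (x j) (y j)

/-- The operator acting as `σ` on the qubit `j` and as the identity on the other qubits. -/
def siteOp {α : Type} [Fintype α] [DecidableEq α] (j : α) (σ : Matrix (Fin 2) (Fin 2) ℂ) : Op α :=
  siteTensor (Function.update (fun _ => 1) j σ)

/-- The bit flip. -/
def sigmaX : Matrix (Fin 2) (Fin 2) ℂ := !![0, 1; 1, 0]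

/-- The phase flip. -/
def sigmaZ : Matrix (Fin 2) (Fin 2) ℂ := !![1, 0; 0, -1]

/-- The tensor product `A ⊗ B` of an operator on the qubits `α` and one on the qubits `β`. -/
def tensorOp {α β : Type} (A : Op α) (B : Op β) : Op (α ⊕ β) :=
  (A ⊗ₖ B).submatrix (Equiv.sumArrowEquivProdArrow α β (Fin 2))
    (Equiv.sumArrowEquivProdArrow α β (Fin 2))

section Helpers

variable {α β : Type} [Fintype α] [DecidableEq α] [Fintype β] [DecidableEq β]

lemma siteTensor_one : siteTensor (fun _ : α => 1) = 1 := by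
  ext x y
  simp only [siteTensor, Matrix.of_apply, Matrix.one_apply]
  by_cases h : x = y
  · simp [h]
  · obtain ⟨j, hj⟩ := Function.ne_iff.mp h
    rw [if_neg h]
    exact Finset.prod_eq_zero (Finset.mem_univ j) (if_neg hj)

lemma siteTensor_mul (σ τ : α → Matrix (Fin 2) (Fin 2) ℂ) :
    siteTensor σ * siteTensor τ = siteTensor (fun j => σ j * τ j) := by
  ext x y
  simp only [siteTensor, Matrix.of_apply, Matrix.mul_apply, ← Finset.prod_mul_distrib]
  rw [Finset.prod_univ_sum]
  simp

lemma siteTensor_star (σ : α → Matrix (Fin 2) (Fin 2) ℂ) :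
    star (siteTensor σ) = siteTensor (fun j => star (σ j)) := by
  ext x y
  simp [siteTensor, Matrix.star_apply]

lemma siteOp_mul (j : α) (σ τ : Matrix (Fin 2) (Fin 2) ℂ) :
    siteOp j σ * siteOp j τ = siteOp j (σ * τ) := by
  unfold siteOp
  rw [siteTensor_mul]
  congr 1
  funext k
  by_cases h : k = j
  · subst h; simp
  · simp [h]

lemma siteOp_star (j : α) (σ : Matrix (Fin 2) (Fin 2) ℂ) :
    star (siteOp j σ) = siteOp j (star σ) := by
  unfold siteOp
  rw [siteTensor_star]
  congr 1
  funext k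
  by_cases h : k = j
  · subst h; simp
  · simp [h]

lemma siteOp_one (j : α) : siteOp j 1 = 1 := by
  unfold siteOp
  rw [← siteTensor_one]
  congr 1
  funext k
  by_cases h : k = j
  · subst h; simp
  · simp [h]

lemma siteOp_mem_unitaryGroup (j : α) {σ : Matrix (Fin 2) (Fin 2) ℂ} (h : σ * star σ = 1) :
    siteOp j σ ∈ Matrix.unitaryGroup (α → Fin 2) ℂ := by
  rw [Matrix.mem_unitaryGroup_iff, siteOp_star, siteOp_mul, h, siteOp_one]

lemma sigmaX_mul_star : sigmaX * star sigmaX = 1 := by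
  ext i j
  fin_cases i <;> fin_cases j <;>
    simp [sigmaX, Matrix.mul_apply, Matrix.star_apply, Fin.sum_univ_two]

lemma sigmaZ_mul_star : sigmaZ * star sigmaZ = 1 := by
  ext i j
  fin_cases i <;> fin_cases j <;>
    simp [sigmaZ, Matrix.mul_apply, Matrix.star_apply, Fin.sum_univ_two]

lemma I_smul_one_mem_unitaryGroup :
    (Complex.I • (1 : Op α)) ∈ Matrix.unitaryGroup (α → Fin 2) ℂ := by
  rw [Matrix.mem_unitaryGroup_iff]
  simp [star_smul, smul_smul]

lemma tensorOp_mul (A A' : Op α) (B B' : Op β) :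
    tensorOp A B * tensorOp A' B' = tensorOp (A * A') (B * B') := by
  unfold tensorOp
  rw [Matrix.submatrix_mul_equiv, Matrix.mul_kronecker_mul]

lemma tensorOp_star (A : Op α) (B : Op β) :
    star (tensorOp A B) = tensorOp (star A) (star B) := by
  ext x y
  simp [tensorOp, Matrix.star_apply]

lemma tensorOp_one : tensorOp (1 : Op α) (1 : Op β) = 1 := by
  unfold tensorOp
  rw [Matrix.one_kronecker_one]
  simp

lemma tensorOp_mem_unitaryGroup {A : Op α} {B : Op β}
    (hA : A ∈ Matrix.unitaryGroup (α → Fin 2) ℂ) (hB : B ∈ Matrix.unitaryGroup (β → Fin 2) ℂ) :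
    tensorOp A B ∈ Matrix.unitaryGroup (α ⊕ β → Fin 2) ℂ := by
  rw [Matrix.mem_unitaryGroup_iff] at *
  rw [tensorOp_star, tensorOp_mul, hA, hB, tensorOp_one]

end Helpers

/-- The unitary bit flip on the qubit `j`. -/
def pauliX {α : Type} [Fintype α] [DecidableEq α] (j : α) : Matrix.unitaryGroup (α → Fin 2) ℂ :=
  ⟨siteOp j sigmaX, siteOp_mem_unitaryGroup j sigmaX_mul_star⟩

/-- The unitary phase flip on the qubit `j`. -/
def pauliZ {α : Type} [Fintype α] [DecidableEq α] (j : α) : Matrix.unitaryGroup (α → Fin 2) ℂ :=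
  ⟨siteOp j sigmaZ, siteOp_mem_unitaryGroup j sigmaZ_mul_star⟩

/-- The scalar unitary `iI`. -/
def phaseI (α : Type) [Fintype α] [DecidableEq α] : Matrix.unitaryGroup (α → Fin 2) ℂ :=
  ⟨Complex.I • 1, I_smul_one_mem_unitaryGroup⟩

/-- The Pauli group on the qubits labelled by `α`: the group of unitaries generated by the bit
flips, the phase flips and `iI`. -/
def pauliGroup (α : Type) [Fintype α] [DecidableEq α] :
    Subgroup (Matrix.unitaryGroup (α → Fin 2) ℂ) :=
  Subgroup.closure (Set.range pauliX ∪ Set.range pauliZ ∪ {phaseI α})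

/-- The Pauli group as a type. Inverses in it are adjoints of operators. -/
abbrev Pauli (α : Type) [Fintype α] [DecidableEq α] := ↥(pauliGroup α)

/-- The matrix of a Pauli operator. -/
def Pauli.op {α : Type} [Fintype α] [DecidableEq α] (g : Pauli α) : Op α := g.1.1

/-- The element `iI` of the Pauli group. -/
def Pauli.iI (α : Type) [Fintype α] [DecidableEq α] : Pauli α :=
  ⟨phaseI α, Subgroup.subset_closure (Or.inr rfl)⟩

section Tensor

variable {α β : Type} [Fintype α] [DecidableEq α] [Fintype β] [DecidableEq β]

/-- `(U, V) ↦ U ⊗ V` on unitaries. -/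
def unitaryTensor : Matrix.unitaryGroup (α → Fin 2) ℂ × Matrix.unitaryGroup (β → Fin 2) ℂ →*
    Matrix.unitaryGroup (α ⊕ β → Fin 2) ℂ where
  toFun p := ⟨tensorOp p.1.1 p.2.1, tensorOp_mem_unitaryGroup p.1.2 p.2.2⟩
  map_one' := Subtype.ext tensorOp_one
  map_mul' p q := Subtype.ext (tensorOp_mul p.1.1 q.1.1 p.2.1 q.2.1).symm

lemma tensorOp_siteOp_one (j : α) (σ : Matrix (Fin 2) (Fin 2) ℂ) :
    tensorOp (siteOp j σ) (1 : Op β) = siteOp (Sum.inl j) σ := by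
  rw [← siteTensor_one]
  ext x y
  simp only [tensorOp, siteOp, siteTensor, Matrix.submatrix_apply, Matrix.kroneckerMap_apply,
    Matrix.of_apply, Fintype.prod_sum_type]
  congr 1
  refine Finset.prod_congr rfl fun k _ => ?_
  by_cases h : k = j
  · subst h; simp [Equiv.sumArrowEquivProdArrow]
  · simp [h, Equiv.sumArrowEquivProdArrow]

lemma tensorOp_one_siteOp (j : β) (σ : Matrix (Fin 2) (Fin 2) ℂ) :
    tensorOp (1 : Op α) (siteOp j σ) = siteOp (Sum.inr j) σ := by
  rw [← siteTensor_one]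
  ext x y
  simp only [tensorOp, siteOp, siteTensor, Matrix.submatrix_apply, Matrix.kroneckerMap_apply,
    Matrix.of_apply, Fintype.prod_sum_type]
  congr 1
  refine Finset.prod_congr rfl fun k _ => ?_
  by_cases h : k = j
  · subst h; simp [Equiv.sumArrowEquivProdArrow]
  · simp [h, Equiv.sumArrowEquivProdArrow]

lemma unitaryTensor_left_mem {U : Matrix.unitaryGroup (α → Fin 2) ℂ} (hU : U ∈ pauliGroup α) :
    unitaryTensor (U, (1 : Matrix.unitaryGroup (β → Fin 2) ℂ)) ∈ pauliGroup (α ⊕ β) := by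
  have key : pauliGroup α ≤ (pauliGroup (α ⊕ β)).comap
      (unitaryTensor.comp (MonoidHom.inl _ (Matrix.unitaryGroup (β → Fin 2) ℂ))) := by
    refine (Subgroup.closure_le _).mpr ?_
    rintro _ ((⟨j, rfl⟩ | ⟨j, rfl⟩) | rfl)
    · exact Subgroup.subset_closure
        (Or.inl (Or.inl ⟨Sum.inl j, Subtype.ext (tensorOp_siteOp_one j _).symm⟩))
    · exact Subgroup.subset_closure
        (Or.inl (Or.inr ⟨Sum.inl j, Subtype.ext (tensorOp_siteOp_one j _).symm⟩))
    · refine Subgroup.subset_closure (Or.inr (Subtype.ext ?_))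
      change tensorOp (Complex.I • (1 : Op α)) (1 : Op β) = Complex.I • 1
      rw [← tensorOp_one (α := α) (β := β)]
      ext x y
      exact mul_assoc _ _ _
  exact key hU

lemma unitaryTensor_right_mem {V : Matrix.unitaryGroup (β → Fin 2) ℂ} (hV : V ∈ pauliGroup β) :
    unitaryTensor ((1 : Matrix.unitaryGroup (α → Fin 2) ℂ), V) ∈ pauliGroup (α ⊕ β) := by
  have key : pauliGroup β ≤ (pauliGroup (α ⊕ β)).comap
      (unitaryTensor.comp (MonoidHom.inr (Matrix.unitaryGroup (α → Fin 2) ℂ) _)) := by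
    refine (Subgroup.closure_le _).mpr ?_
    rintro _ ((⟨j, rfl⟩ | ⟨j, rfl⟩) | rfl)
    · exact Subgroup.subset_closure
        (Or.inl (Or.inl ⟨Sum.inr j, Subtype.ext (tensorOp_one_siteOp j _).symm⟩))
    · exact Subgroup.subset_closure
        (Or.inl (Or.inr ⟨Sum.inr j, Subtype.ext (tensorOp_one_siteOp j _).symm⟩))
    · refine Subgroup.subset_closure (Or.inr (Subtype.ext ?_))
      change tensorOp (1 : Op α) (Complex.I • (1 : Op β)) = Complex.I • 1
      rw [← tensorOp_one (α := α) (β := β)]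
      ext x y
      exact mul_left_comm _ _ _
  exact key hV

/-- `(g, h) ↦ g ⊗ h` on Pauli operators. -/
def Pauli.tensor : Pauli α × Pauli β →* Pauli (α ⊕ β) :=
  (unitaryTensor.comp ((pauliGroup α).subtype.prodMap (pauliGroup β).subtype)).codRestrict
    (pauliGroup (α ⊕ β)) fun p => by
      have h : ((pauliGroup α).subtype.prodMap (pauliGroup β).subtype) p =
          ((p.1 : Matrix.unitaryGroup (α → Fin 2) ℂ), 1) * (1, p.2.1) := by simp; rfl
      rw [MonoidHom.comp_apply, h, map_mul]
      exact mul_mem (unitaryTensor_left_mem p.1.2) (unitaryTensor_right_mem p.2.2)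

lemma Pauli.op_tensor (g : Pauli α) (h : Pauli β) :
    (Pauli.tensor (g, h)).op = tensorOp g.op h.op := rfl

lemma Pauli.op_inv (g : Pauli α) : (g⁻¹).op = (g.op)ᴴ := rfl

lemma Pauli.op_mul (g h : Pauli α) : (g * h).op = g.op * h.op := rfl

end Tensor

/-! ### Stabilizer codes -/

section Stabilizer

variable {α : Type} [Fintype α] [DecidableEq α]

/-- The orthogonal projection onto a subspace, as a matrix. -/
def projector (K : Submodule ℂ (QubitSpace α)) : Op α :=
  (Matrix.toEuclideanCLM (n := α → Fin 2) (𝕜 := ℂ)).symm K.starProjection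

/-- The stabilizer subspace: the joint eigenvalue-`1` eigenspace of a set of Pauli operators. -/
def stabilizerSpace (S : Set (Pauli α)) : Submodule ℂ (QubitSpace α) where
  carrier := {ψ | ∀ g ∈ S, Matrix.toEuclideanCLM (n := α → Fin 2) (𝕜 := ℂ) g.op ψ = ψ}
  add_mem' ha hb g hg := by rw [map_add, ha g hg, hb g hg]
  zero_mem' g _ := map_zero _
  smul_mem' c ψ h g hg := by rw [map_smul, h g hg]

/-- The algebra, with unit `P`, generated by the compressions `g P` of the operators `g ∈ A`. -/
def compressionAlgebra (P : Op α) (A : Set (Pauli α)) : NonUnitalStarSubalgebra ℂ (Op α) :=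
  NonUnitalStarAlgebra.adjoin ℂ (insert P {M | ∃ g ∈ A, M = g.op * P})

end Stabilizer

/-! ### Operator algebra quantum error correction -/

section Correctability

variable {α : Type} [Fintype α] [DecidableEq α]

/-- The operators `K a` are the Kraus operators of a quantum channel
`ρ ↦ ∑ a, K a * ρ * (K a)ᴴ`. -/
def IsChannel {q : ℕ} (K : Fin q → Op α) : Prop := ∑ a, (K a)ᴴ * K a = 1

/-- The dual (Heisenberg picture) of the channel with Kraus operators `K a`. -/
def dualChannel {q : ℕ} (K : Fin q → Op α) (X : Op α) : Op α := ∑ a, (K a)ᴴ * X * K a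

/-- A set `A` of observables is correctable, on states supported on the range of the projection
`Q`, for the set of error operators `Err`: there is one recovery channel `R` that restores `A`
after every channel `N` each of whose noise operators is a scalar multiple of an element of `Err`;
that is, `Q (R ∘ N)†(X) Q = Q X Q` for all `X ∈ A`. -/
def IsCorrectable (Q : Op α) (A : Set (Op α)) (Err : Set (Op α)) : Prop :=
  ∃ (p : ℕ) (R : Fin p → Op α), IsChannel R ∧
    ∀ (q : ℕ) (N : Fin q → Op α), IsChannel N → (∀ a, ∃ F ∈ Err, ∃ c : ℂ, N a = c • F) →
      ∀ X ∈ A, Q * dualChannel N (dualChannel R X) * Q = Q * X * Q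

end Correctability

/-! ### Entanglement-assisted codes -/

/-- Labels of the generators `Z̄ 1, …, Z̄ e`, `X̄ 1, …, X̄ e` of the symplectic subgroup and of the
`s` generators of the isotropic subgroup. -/
abbrev GenIndex (e s : ℕ) := (Fin e ⊕ Fin e) ⊕ Fin s

/-- An `n`-qubit Pauli subgroup `H`, given by generators in symplectic/isotropic form, together
with an extension of these generators to `e` further qubits (Bob's halves of the ebits), one per
symplectic pair, which generates an Abelian group `S` without `-I`. -/
structure ExtendedSubgroup (n e s : ℕ) where
  /-- the generators of `H` -/
  gen : GenIndex e s → Pauli (Fin n)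
  /-- no generator lies in the group generated by the others and the phases -/
  gen_indep : ∀ i, gen i ∉ Subgroup.closure (gen '' {j | j ≠ i} ∪ {Pauli.iI (Fin n)})
  /-- `Z̄ i` anticommutes with `X̄ i` -/
  gen_anticomm : ∀ i : Fin e, (gen (.inl (.inl i))).op * (gen (.inl (.inr i))).op =
    -((gen (.inl (.inr i))).op * (gen (.inl (.inl i))).op)
  /-- `Z̄ i` commutes with `X̄ j` for `j ≠ i` -/
  gen_comm : ∀ i j : Fin e, i ≠ j → Commute (gen (.inl (.inl i))) (gen (.inl (.inr j)))
  /-- the `Z̄ i` commute with each other -/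
  gen_comm_Z : ∀ i j : Fin e, Commute (gen (.inl (.inl i))) (gen (.inl (.inl j)))
  /-- the `X̄ i` commute with each other -/
  gen_comm_X : ∀ i j : Fin e, Commute (gen (.inl (.inr i))) (gen (.inl (.inr j)))
  /-- the isotropic generators commute with all generators -/
  gen_comm_iso : ∀ (i : Fin s) (j : GenIndex e s), Commute (gen (.inr i)) (gen j)
  /-- the action of the extended generators on Bob's qubits -/
  bob : GenIndex e s → Pauli (Fin e)
  /-- the extended generators commute -/
  ext_comm : ∀ i j, Commute (Pauli.tensor (gen i, bob i)) (Pauli.tensor (gen j, bob j))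
  /-- `-I` is not in the group generated by the extended generators -/
  neg_one_notMem : ∀ g ∈ Subgroup.closure (Set.range fun i => Pauli.tensor (gen i, bob i)),
    g.op ≠ -1

namespace ExtendedSubgroup

variable {n e s : ℕ} (D : ExtendedSubgroup n e s)

/-- The group `H` on the original qubits. -/
def H : Subgroup (Pauli (Fin n)) := Subgroup.closure (Set.range D.gen)

/-- The isotropic subgroup of `H`. -/
def HI : Subgroup (Pauli (Fin n)) := Subgroup.closure (Set.range fun i : Fin s => D.gen (.inr i))

/-- The Abelian group `S` on the extended system. -/
def S : Subgroup (Pauli (Fin n ⊕ Fin e)) :=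
  Subgroup.closure (Set.range fun i => Pauli.tensor (D.gen i, D.bob i))

/-- The normalizer of `S` in the extended Pauli group. -/
def NS : Subgroup (Pauli (Fin n ⊕ Fin e)) := Subgroup.normalizer (D.S : Set (Pauli (Fin n ⊕ Fin e)))

/-- The base code space `C(S)`. -/
def codeSpace : Submodule ℂ (QubitSpace (Fin n ⊕ Fin e)) :=
  stabilizerSpace (D.S : Set (Pauli (Fin n ⊕ Fin e)))

/-- The code space projector. -/
def P : Op (Fin n ⊕ Fin e) := projector D.codeSpace

end ExtendedSubgroup

/-- An `n`-qubit entanglement-assisted code `C(H, S, G₀, L₀, T₀)` with `e` ebits, `s` isotropic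
qubits, `r` gauge qubits and `k` logical qubits. -/
structure Code (n e s r k : ℕ) extends ExtendedSubgroup n e s where
  /-- the gauge operators -/
  G₀ : Set (Pauli (Fin n ⊕ Fin e))
  /-- the logical operators -/
  L₀ : Set (Pauli (Fin n ⊕ Fin e))
  /-- the transversal operators -/
  T₀ : Set (Pauli (Fin n ⊕ Fin e))
  /-- gauge operators act as the identity on the ebits -/
  gauge_ext : ∀ g ∈ G₀, ∃ h : Pauli (Fin n), g = Pauli.tensor (h, 1)
  /-- logical operators act as the identity on the ebits -/
  logical_ext : ∀ g ∈ L₀, ∃ h : Pauli (Fin n), g = Pauli.tensor (h, 1)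
  /-- the compressed gauge operators generate a full matrix algebra -/
  gauge_algebra : Nonempty (compressionAlgebra toExtendedSubgroup.P G₀ ≃⋆ₐ[ℂ]
    Matrix (Fin (2 ^ r)) (Fin (2 ^ r)) ℂ)
  /-- the compressed logical operators generate a full matrix algebra -/
  logical_algebra : Nonempty (compressionAlgebra toExtendedSubgroup.P L₀ ≃⋆ₐ[ℂ]
    Matrix (Fin (2 ^ k)) (Fin (2 ^ k)) ℂ)
  /-- gauge and logical operators commute -/
  gauge_logical_comm : ∀ g ∈ G₀, ∀ l ∈ L₀, Commute g l
  /-- the normalizer of `S` is generated by `S`, `iI`, `G₀` and `L₀` -/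
  normalizer_eq : toExtendedSubgroup.NS =
    Subgroup.closure ((toExtendedSubgroup.S : Set (Pauli (Fin n ⊕ Fin e))) ∪
      {Pauli.iI (Fin n ⊕ Fin e)} ∪ G₀ ∪ L₀)
  /-- the identity is one of the transversal operators -/
  one_mem_T₀ : 1 ∈ T₀
  /-- `T₀` is part of a transversal for the cosets `g N(S)` in the extended Pauli group -/
  T₀_transversal : ∃ T : Set (Pauli (Fin n ⊕ Fin e)),
    Subgroup.IsComplement T (toExtendedSubgroup.NS : Set (Pauli (Fin n ⊕ Fin e))) ∧ T₀ ⊆ T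

namespace Code

variable {n e s r k : ℕ} (C : Code n e s r k)

/-- The operators `g` on the original qubits with `g ⊗ I` in the set `A`. -/
def alice {n e : ℕ} (A : Set (Pauli (Fin n ⊕ Fin e))) : Set (Pauli (Fin n)) :=
  {g | Pauli.tensor (g, 1) ∈ A}

/-- The whole code space: the span of the sectors `T C(S)`, `T ∈ T₀`. -/
def hybridSpace : Submodule ℂ (QubitSpace (Fin n ⊕ Fin e)) :=
  ⨆ T ∈ C.T₀, C.codeSpace.map
    (Matrix.toEuclideanCLM (n := Fin n ⊕ Fin e → Fin 2) (𝕜 := ℂ) T.op).toLinearMap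

/-- The algebra encoded by the code: the sum over `T ∈ T₀` of the algebras `T 𝓐 T†`, where `𝓐` is
the algebra of the compressed logical operators on the base code space. -/
def logicalAlgebra : Submodule ℂ (Op (Fin n ⊕ Fin e)) :=
  Submodule.span ℂ {X | ∃ T ∈ C.T₀, ∃ Y ∈ compressionAlgebra C.P C.L₀, X = T.op * Y * (T.op)ᴴ}

/-- The set of errors `E ⊗ I`, `E ∈ Err`, is correctable for the code. -/
def Correctable (Err : Set (Pauli (Fin n))) : Prop :=
  IsCorrectable (projector C.hybridSpace) C.logicalAlgebra
    {F | ∃ E ∈ Err, F = tensorOp E.op 1}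

end Code

end EAOAQEC

end

/-!
Errors restrict to Pauli operators, and two Pauli operators either commute or anticommute. Hence a
Pauli operator on the extended system either lies in the normalizer `N(S)`, which is the
centralizer of `S` because `-I ∉ S`, and commutes with the code projection `P`, or satisfies
`P g P = 0` (`ExtendedSubgroup.P_mul_op_mul_P`). Correctability is thereby decided by the cosets of
`N(S)` to which the operators `E T` belong, with `E` an error and `T` a transversal operator.

*Necessity.* A recovery that preserves an observable `X` together with `X†` and `X† X` has Kraus
operators commuting with `X` on the code space (`comm_kraus_of_preserves`), so the compression of
`E† F` to the code space commutes with all encoded observables. The sector projections are such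
observables, so `E† F` does not lead from one sector to another
(`Code.not_mem_of_correctable`). If `E† F` normalizes `S`, it commutes with the logical operators;
the logical algebra is a full matrix algebra, so the logical part of `E† F` acts on `C(S)` as a
scalar and is an element of `S` up to a phase. Here a trace argument is used: `P` is the average
of `S`, and non-scalar Pauli operators are traceless. Hence `E† F` lies in the group generated by
`S`, `iI` and the gauge operators (`Code.mem_gaugeGroup_of_correctable`).

*Sufficiency.* The projections onto the subspaces `g C(S)`, one for each coset `g N(S)`, sum to the
identity and define a syndrome measurement. Under the hypothesis a syndrome determines the sector
and determines the error up to gauge operators, which commute with all encoded observables. So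
undoing any error compatible with the measured syndrome restores the observables
(`Code.correctable_of_gauge`).

*Bob's qubits.* The condition is stated in terms of operators on Alice's qubits. An operator `E ⊗ I`
is in the group generated by `S`, `iI` and the gauge operators iff `E` is in the group generated by
the isotropic subgroup, `iI` and the gauge operators on Alice's side
(`Code.inl_mem_gaugeGroup`, `Code.mem_aliceGaugeGroup`). On Bob's `e` qubits the parts of the `2e`
symplectic generators have the commutation relations of a symplectic basis. Therefore the parts of
the isotropic generators, which commute with them, are phases, and an element of `S` that is trivial
on Bob's qubits contains no symplectic generator.
-/

namespace EAOAQEC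

/-! ### Commutation in the Pauli group -/

section PauliGroup

variable {α : Type} [Fintype α] [DecidableEq α]

lemma Pauli.op_injective : Function.Injective (Pauli.op : Pauli α → Op α) :=
  fun _ _ h => Subtype.ext (Subtype.ext h)

lemma Pauli.op_one : (1 : Pauli α).op = 1 := rfl

lemma Pauli.op_iI : (Pauli.iI α).op = Complex.I • 1 := rfl

lemma Pauli.op_mul_op_inv (g : Pauli α) : g.op * (g⁻¹).op = 1 := by
  rw [← Pauli.op_mul, mul_inv_cancel, Pauli.op_one]

lemma Pauli.op_inv_mul_op (g : Pauli α) : (g⁻¹).op * g.op = 1 := by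
  rw [← Pauli.op_mul, inv_mul_cancel, Pauli.op_one]

/-- The Pauli operator `-I`. -/
def Pauli.negOne (α : Type) [Fintype α] [DecidableEq α] : Pauli α := Pauli.iI α * Pauli.iI α

lemma Pauli.op_negOne : (Pauli.negOne α).op = -1 := by
  rw [Pauli.negOne, Pauli.op_mul, Pauli.op_iI]
  simp [smul_smul]

lemma Pauli.op_negOne_mul (g : Pauli α) : (Pauli.negOne α * g).op = -g.op := by
  rw [Pauli.op_mul, Pauli.op_negOne, neg_one_mul]

lemma Pauli.negOne_mul_negOne_mul (g : Pauli α) :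
    Pauli.negOne α * (Pauli.negOne α * g) = g := by
  apply Pauli.op_injective
  simp [Pauli.op_negOne_mul]

lemma Pauli.negOne_comm (g : Pauli α) : Pauli.negOne α * g = g * Pauli.negOne α := by
  apply Pauli.op_injective
  simp [Pauli.op_mul, Pauli.op_negOne]

lemma Pauli.iI_comm (g : Pauli α) : Commute (Pauli.iI α) g := by
  apply Pauli.op_injective
  simp [Pauli.op_mul, Pauli.op_iI]

lemma Pauli.negOne_mul_ne (g : Pauli α) : Pauli.negOne α * g ≠ g := by
  intro h
  have h1 : Pauli.negOne α = 1 := by simpa using h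
  have h2 := congrArg Pauli.op h1
  rw [Pauli.op_negOne, Pauli.op_one] at h2
  have h3 := congrFun (congrFun h2 0) 0
  norm_num at h3

lemma siteOp_comm_of_ne {j k : α} (h : j ≠ k) (σ τ : Matrix (Fin 2) (Fin 2) ℂ) :
    siteOp j σ * siteOp k τ = siteOp k τ * siteOp j σ := by
  unfold siteOp
  rw [siteTensor_mul, siteTensor_mul]
  congr 1
  funext l
  by_cases h1 : l = j
  · subst h1; simp [h]
  · simp [h1]

lemma siteOp_apply (j : α) (σ : Matrix (Fin 2) (Fin 2) ℂ) (x y : α → Fin 2) :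
    siteOp j σ x y = σ (x j) (y j) * ∏ k ∈ Finset.univ.erase j, (1 : Matrix _ _ ℂ) (x k) (y k) := by
  simp only [siteOp, siteTensor, Matrix.of_apply]
  rw [← Finset.mul_prod_erase _ _ (Finset.mem_univ j)]
  congr 1
  · simp
  · refine Finset.prod_congr rfl fun k hk => ?_
    rw [Function.update_of_ne (Finset.ne_of_mem_erase hk)]

lemma siteOp_neg (j : α) (σ : Matrix (Fin 2) (Fin 2) ℂ) : siteOp j (-σ) = -siteOp j σ := by
  ext x y
  simp [siteOp_apply]

lemma sigmaX_mul_sigmaZ : sigmaX * sigmaZ = -(sigmaZ * sigmaX) := by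
  ext i j
  fin_cases i <;> fin_cases j <;> simp [sigmaX, sigmaZ, Matrix.mul_apply, Fin.sum_univ_two]

lemma siteOp_sigmaX_mul_siteOp_sigmaZ (j k : α) :
    siteOp j sigmaX * siteOp k sigmaZ = siteOp k sigmaZ * siteOp j sigmaX ∨
      siteOp j sigmaX * siteOp k sigmaZ = -(siteOp k sigmaZ * siteOp j sigmaX) := by
  by_cases h : j = k
  · subst h
    right
    rw [siteOp_mul, siteOp_mul, sigmaX_mul_sigmaZ, siteOp_neg]
  · exact .inl (siteOp_comm_of_ne h _ _)

lemma siteOp_self_comm (j k : α) (σ : Matrix (Fin 2) (Fin 2) ℂ) :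
    siteOp j σ * siteOp k σ = siteOp k σ * siteOp j σ := by
  by_cases h : j = k
  · rw [h]
  · exact siteOp_comm_of_ne h _ _

lemma pauliGroup_comm_or_anticomm {U V : Matrix.unitaryGroup (α → Fin 2) ℂ}
    (hU : U ∈ pauliGroup α) (hV : V ∈ pauliGroup α) : U * V = V * U ∨ U * V = -(V * U) := by
  refine Subgroup.closure_induction₂ (p := fun U V _ _ => U * V = V * U ∨ U * V = -(V * U))
    ?_ ?_ ?_ ?_ ?_ ?_ ?_ hU hV
  · rintro _ _ ((⟨j, rfl⟩ | ⟨j, rfl⟩) | rfl) ((⟨k, rfl⟩ | ⟨k, rfl⟩) | rfl)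
    · exact .inl (Subtype.ext (siteOp_self_comm j k _))
    · exact (siteOp_sigmaX_mul_siteOp_sigmaZ j k).imp (fun h => Subtype.ext h)
        fun h => Subtype.ext h
    · exact .inl (Subtype.ext (by simp [phaseI]))
    · refine (siteOp_sigmaX_mul_siteOp_sigmaZ k j).imp (fun h => Subtype.ext h.symm)
        fun h => Subtype.ext (?_ : siteOp j sigmaZ * siteOp k sigmaX = -_)
      exact (neg_eq_iff_eq_neg.mpr h).symm
    · exact .inl (Subtype.ext (siteOp_self_comm j k _))
    · exact .inl (Subtype.ext (by simp [phaseI]))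
    all_goals exact .inl (Subtype.ext (by simp [phaseI]))
  · simp
  · simp
  · rintro x y z - - - (h1 | h1) (h2 | h2)
    · exact .inl (Commute.mul_left h1 h2)
    · right; rw [mul_assoc, h2, mul_neg, ← mul_assoc, h1, mul_assoc]
    · right; rw [mul_assoc, h2, ← mul_assoc, h1, neg_mul, mul_assoc]
    · left; rw [mul_assoc, h2, mul_neg, ← mul_assoc, h1, neg_mul, neg_neg, mul_assoc]
  · rintro x y z - - - (h1 | h1) (h2 | h2)
    · exact .inl (Commute.mul_right h1 h2)
    · right; rw [← mul_assoc, h1, mul_assoc, h2, mul_neg, mul_assoc]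
    · right; rw [← mul_assoc, h1, neg_mul, mul_assoc, h2, mul_assoc]
    · left; rw [← mul_assoc, h1, neg_mul, mul_assoc, h2, mul_neg, neg_neg, mul_assoc]
  · rintro x y - - (h | h)
    · exact .inl (Commute.inv_left h)
    · right
      rw [inv_mul_eq_iff_eq_mul, mul_neg, ← mul_assoc, ← neg_mul, h, neg_neg, mul_inv_cancel_right]
  · rintro x y - - (h | h)
    · exact .inl (Commute.inv_right h)
    · right
      rw [mul_inv_eq_iff_eq_mul, neg_mul, mul_assoc, ← mul_neg, h, neg_neg, inv_mul_cancel_left]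

/-- Two Pauli operators commute or anticommute. -/
lemma Pauli.commute_or_anticommute (g h : Pauli α) :
    Commute g h ∨ g * h = Pauli.negOne α * (h * g) := by
  refine (pauliGroup_comm_or_anticomm g.2 h.2).imp (fun H => Subtype.ext H) fun H => ?_
  apply Pauli.op_injective
  rw [Pauli.op_negOne_mul]
  exact congrArg Subtype.val H

open Classical in
/-- The sign by which a Pauli operator commutes with `h`, as a character of the Pauli group. -/
noncomputable def Pauli.commSign (h : Pauli α) : Pauli α →* ℤˣ where
  toFun g := if Commute g h then 1 else -1
  map_one' := if_pos (Commute.one_left h)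
  map_mul' g g' := by
    rcases Pauli.commute_or_anticommute g h with h1 | h1 <;>
    rcases Pauli.commute_or_anticommute g' h with h2 | h2
    · rw [if_pos h1, if_pos h2, if_pos (h1.mul_left h2), one_mul]
    · have n2 : ¬ Commute g' h := fun H => Pauli.negOne_mul_ne _ (h2.symm.trans H)
      rw [if_pos h1, if_neg n2, if_neg, one_mul]
      exact fun H => n2 (by simpa using h1.inv_left.mul_left H)
    · have n1 : ¬ Commute g h := fun H => Pauli.negOne_mul_ne _ (h1.symm.trans H)
      rw [if_neg n1, if_pos h2, if_neg, mul_one]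
      exact fun H => n1 (by simpa using H.mul_left h2.inv_left)
    · have n1 : ¬ Commute g h := fun H => Pauli.negOne_mul_ne _ (h1.symm.trans H)
      have n2 : ¬ Commute g' h := fun H => Pauli.negOne_mul_ne _ (h2.symm.trans H)
      rw [if_neg n1, if_neg n2, if_pos]
      · rfl
      · change g * g' * h = h * (g * g')
        rw [mul_assoc, h2, ← mul_assoc, ← Pauli.negOne_comm, mul_assoc, ← mul_assoc g, h1,
          mul_assoc, Pauli.negOne_mul_negOne_mul, mul_assoc]

lemma Pauli.commSign_eq_one {g h : Pauli α} : Pauli.commSign h g = 1 ↔ Commute g h := by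
  classical
  change (if Commute g h then (1 : ℤˣ) else -1) = 1 ↔ _
  split_ifs with H <;> simp [H]

lemma Pauli.commSign_of_anticommute {g h : Pauli α} (H : ¬ Commute g h) :
    Pauli.commSign h g = -1 := by
  classical
  exact if_neg H

/-! ### The centre of the Pauli group -/

/-- The bit flip on the qubit `j`, as an element of the Pauli group. -/
noncomputable def Pauli.X (j : α) : Pauli α :=
  ⟨pauliX j, Subgroup.subset_closure (.inl (.inl ⟨j, rfl⟩))⟩

/-- The phase flip on the qubit `j`, as an element of the Pauli group. -/
noncomputable def Pauli.Z (j : α) : Pauli α :=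
  ⟨pauliZ j, Subgroup.subset_closure (.inl (.inr ⟨j, rfl⟩))⟩

lemma prod_erase_one_apply (j : α) (x y : α → Fin 2) :
    ∏ k ∈ Finset.univ.erase j, (1 : Matrix (Fin 2) (Fin 2) ℂ) (x k) (y k) =
      if y = Function.update x j (y j) then 1 else 0 := by
  split_ifs with h
  · refine Finset.prod_eq_one fun k hk => ?_
    rw [h, Function.update_of_ne (Finset.ne_of_mem_erase hk), Matrix.one_apply_eq]
  · rw [Function.eq_update_iff] at h
    push Not at h
    obtain ⟨k, hk, hne⟩ := h rfl
    exact Finset.prod_eq_zero (Finset.mem_erase.mpr ⟨hk, Finset.mem_univ k⟩)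
      (Matrix.one_apply_ne hne.symm)

lemma siteOp_sigmaZ_eq_diagonal (j : α) :
    siteOp j sigmaZ = Matrix.diagonal fun x : α → Fin 2 => sigmaZ (x j) (x j) := by
  ext x y
  rw [siteOp_apply, prod_erase_one_apply, Matrix.diagonal_apply]
  by_cases h : x = y
  · subst h; simp
  · rw [if_neg h]
    by_cases h1 : x j = y j
    · rw [if_neg, mul_zero]
      rw [← h1, Function.update_eq_self]
      exact fun H => h H.symm
    · have : sigmaZ (x j) (y j) = 0 := by
        revert h1
        generalize x j = a; generalize y j = b
        fin_cases a <;> fin_cases b <;> simp [sigmaZ]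
      rw [this, zero_mul]

lemma siteOp_sigmaX_apply (j : α) (x y : α → Fin 2) :
    siteOp j sigmaX x y = if y = Function.update x j (1 - x j) then 1 else 0 := by
  rw [siteOp_apply, prod_erase_one_apply]
  by_cases h1 : y j = 1 - x j
  · rw [h1]
    have : sigmaX (x j) (1 - x j) = 1 := by
      generalize x j = a
      fin_cases a <;> simp [sigmaX]
    rw [this, one_mul]
  · have : sigmaX (x j) (y j) = 0 := by
      revert h1
      generalize x j = a; generalize y j = b
      fin_cases a <;> fin_cases b <;> simp [sigmaX]
    rw [this, zero_mul, if_neg]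
    rintro rfl
    simp at h1

/-- An operator that commutes with all bit and phase flips is a scalar. -/
lemma exists_eq_smul_one_of_comm (M : Op α)
    (hX : ∀ j, siteOp j sigmaX * M = M * siteOp j sigmaX)
    (hZ : ∀ j, siteOp j sigmaZ * M = M * siteOp j sigmaZ) : ∃ c : ℂ, M = c • 1 := by
  -- commuting with the phase flips kills the off-diagonal entries
  have hoff : ∀ x y, x ≠ y → M x y = 0 := by
    intro x y hxy
    obtain ⟨j, hj⟩ := Function.ne_iff.mp hxy
    have h := congrFun (congrFun (hZ j) x) y
    rw [siteOp_sigmaZ_eq_diagonal, Matrix.diagonal_mul, Matrix.mul_diagonal] at h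
    revert h hj
    generalize x j = a; generalize y j = b
    fin_cases a <;> fin_cases b <;> simp [sigmaZ]
    · intro h
      exact self_eq_neg.mp h
    · intro h
      exact neg_eq_self.mp h
  -- commuting with the bit flips makes the diagonal constant
  have hflip : ∀ j x, M (Function.update x j (1 - x j)) (Function.update x j (1 - x j)) =
      M x x := by
    intro j x
    have h := congrFun (congrFun (hX j) x) (Function.update x j (1 - x j))
    simp only [Matrix.mul_apply, siteOp_sigmaX_apply] at h
    rw [Finset.sum_eq_single (Function.update x j (1 - x j)),
      Finset.sum_eq_single x] at h
    · simpa using h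
    · intro z _ hz
      rw [hoff _ _ hz.symm, zero_mul]
    · simp
    · intro z _ hz
      rw [if_neg hz, zero_mul]
    · simp
  have hupd : ∀ j x v, M (Function.update x j v) (Function.update x j v) = M x x := by
    intro j x v
    by_cases h : v = x j
    · rw [h, Function.update_eq_self]
    · have : v = 1 - x j := by
        revert h
        generalize x j = a
        fin_cases a <;> fin_cases v <;> simp
      rw [this, hflip]
  have hconst : ∀ x y, M x x = M y y := by
    intro x y
    have : ∀ s : Finset α, M (s.piecewise x y) (s.piecewise x y) = M y y := by
      intro s
      induction s using Finset.induction_on with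
      | empty => simp
      | insert j s hj ih => rw [Finset.piecewise_insert, hupd, ih]
    simpa using this Finset.univ
  refine ⟨M 0 0, ?_⟩
  ext x y
  by_cases h : x = y
  · subst h; simpa using hconst x 0
  · simp [h, hoff x y h]

lemma sigmaX_mul_self : sigmaX * sigmaX = 1 := by
  ext i j
  fin_cases i <;> fin_cases j <;> simp [sigmaX, Matrix.mul_apply, Fin.sum_univ_two]

lemma sigmaZ_mul_self : sigmaZ * sigmaZ = 1 := by
  ext i j
  fin_cases i <;> fin_cases j <;> simp [sigmaZ, Matrix.mul_apply, Fin.sum_univ_two]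

lemma pauliGroup_mul_self {U : Matrix.unitaryGroup (α → Fin 2) ℂ} (hU : U ∈ pauliGroup α) :
    U * U = 1 ∨ U * U = -1 := by
  refine Subgroup.closure_induction (p := fun U _ => U * U = 1 ∨ U * U = -1) ?_ ?_ ?_ ?_ hU
  · rintro _ ((⟨j, rfl⟩ | ⟨j, rfl⟩) | rfl)
    · refine .inl (Subtype.ext ?_)
      change siteOp j sigmaX * siteOp j sigmaX = 1
      rw [siteOp_mul, sigmaX_mul_self, siteOp_one]
    · refine .inl (Subtype.ext ?_)
      change siteOp j sigmaZ * siteOp j sigmaZ = 1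
      rw [siteOp_mul, sigmaZ_mul_self, siteOp_one]
    · refine .inr (Subtype.ext ?_)
      change (Complex.I • 1 : Op α) * (Complex.I • 1) = -1
      simp [smul_smul]
  · simp
  · intro x y hx hy h1 h2
    have h3 : x * y * (x * y) = x * (y * x) * y := by simp only [mul_assoc]
    rcases pauliGroup_comm_or_anticomm hy hx with h | h <;>
    rcases h1 with h1 | h1 <;> rcases h2 with h2 | h2 <;>
    · rw [h3, h]
      simp only [mul_neg, neg_mul, ← mul_assoc, h1]
      simp [h2]
  · intro x _ h
    rw [← mul_inv_rev]
    rcases h with h | h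
    · simp [h]
    · right
      rw [h, inv_eq_iff_mul_eq_one]
      simp

lemma Pauli.mul_self_eq (g : Pauli α) : g * g = 1 ∨ g * g = Pauli.negOne α := by
  refine (pauliGroup_mul_self g.2).imp (fun H => Subtype.ext H) fun H => ?_
  apply Pauli.op_injective
  rw [Pauli.op_negOne]
  exact congrArg Subtype.val H

/-- A Pauli operator that commutes with all bit and phase flips is a power of `iI`. -/
lemma Pauli.mem_zpowers_iI {g : Pauli α} (hX : ∀ j, Commute g (Pauli.X j))
    (hZ : ∀ j, Commute g (Pauli.Z j)) : g ∈ Subgroup.zpowers (Pauli.iI α) := by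
  obtain ⟨c, hc⟩ := exists_eq_smul_one_of_comm g.op
    (fun j => congrArg Pauli.op (hX j).symm.eq) (fun j => congrArg Pauli.op (hZ j).symm.eq)
  have key : ∀ k : ℕ, c = Complex.I ^ k → g ∈ Subgroup.zpowers (Pauli.iI α) := by
    rintro k rfl
    refine ⟨k, Pauli.op_injective ?_⟩
    rw [hc]
    clear hc
    simp only [zpow_natCast]
    induction k with
    | zero => simp [Pauli.op_one]
    | succ k ih =>
      rw [pow_succ, Pauli.op_mul, ih, Pauli.op_iI, pow_succ]
      simp [smul_smul, mul_comm]
  rcases Pauli.mul_self_eq g with h | h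
  · have h1 := congrFun (congrFun (congrArg Pauli.op h) 0) 0
    rw [Pauli.op_mul, hc, Pauli.op_one] at h1
    simp at h1
    rcases mul_self_eq_one_iff.mp h1 with h2 | h2
    · exact key 0 (by simpa using h2)
    · exact key 2 (by simpa using h2)
  · have h1 := congrFun (congrFun (congrArg Pauli.op h) 0) 0
    rw [Pauli.op_mul, hc, Pauli.op_negOne] at h1
    simp at h1
    rcases mul_self_eq_mul_self_iff.mp (h1.trans Complex.I_mul_I.symm) with h2 | h2
    · exact key 1 (by simpa using h2)
    · exact key 3 (by simpa [Complex.I_pow_three] using h2)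

lemma Pauli.commute_of_mem_zpowers_iI {g : Pauli α} (hg : g ∈ Subgroup.zpowers (Pauli.iI α))
    (h : Pauli α) : Commute g h := by
  obtain ⟨k, rfl⟩ := hg
  exact (Pauli.iI_comm h).zpow_left k

lemma Pauli.op_of_mem_zpowers_iI {g : Pauli α} (hg : g ∈ Subgroup.zpowers (Pauli.iI α)) :
    ∃ c : ℂ, g.op = c • 1 :=
  exists_eq_smul_one_of_comm g.op
    (fun j => congrArg Pauli.op (Pauli.commute_of_mem_zpowers_iI hg (Pauli.X j)).symm.eq)
    (fun j => congrArg Pauli.op (Pauli.commute_of_mem_zpowers_iI hg (Pauli.Z j)).symm.eq)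

/-- The trace of a non-scalar Pauli operator vanishes, since the operator is conjugate to its
negative. -/
lemma Pauli.trace_op_eq_zero {g : Pauli α} (hg : g ∉ Subgroup.zpowers (Pauli.iI α)) :
    g.op.trace = 0 := by
  have : ∃ h, ¬ Commute g h := by
    by_contra! H
    exact hg (Pauli.mem_zpowers_iI (fun j => H _) fun j => H _)
  obtain ⟨h, hh⟩ := this
  have h1 := congrArg Pauli.op ((Pauli.commute_or_anticommute g h).resolve_left hh)
  rw [Pauli.op_negOne_mul, Pauli.op_mul, Pauli.op_mul] at h1
  have h2 : g.op = -(h.op * g.op * (h⁻¹).op) := by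
    rw [← neg_mul, ← h1, mul_assoc, Pauli.op_mul_op_inv, mul_one]
  have h3 := congrArg Matrix.trace h2
  rw [Matrix.trace_neg, mul_assoc, Matrix.trace_mul_comm, mul_assoc, Pauli.op_inv_mul_op,
    mul_one] at h3
  exact self_eq_neg.mp h3

/-- The commutation signs with all bit and phase flips. -/
noncomputable def Pauli.signs (α : Type) [Fintype α] [DecidableEq α] :
    Pauli α →* (α ⊕ α → ℤˣ) :=
  MonoidHom.pi fun j => Pauli.commSign (j.elim Pauli.X Pauli.Z)

lemma Pauli.ker_signs : (Pauli.signs α).ker = Subgroup.zpowers (Pauli.iI α) := by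
  ext g
  rw [MonoidHom.mem_ker]
  constructor
  · intro h
    exact Pauli.mem_zpowers_iI
      (fun j => Pauli.commSign_eq_one.mp (congrFun h (Sum.inl j)))
      (fun j => Pauli.commSign_eq_one.mp (congrFun h (Sum.inr j)))
  · intro h
    funext j
    exact Pauli.commSign_eq_one.mpr (Pauli.commute_of_mem_zpowers_iI h _)

lemma Pauli.iI_pow_four : Pauli.iI α ^ 4 = 1 := by
  apply Pauli.op_injective
  rw [pow_succ, pow_succ, pow_two, ← Pauli.negOne, mul_assoc, ← Pauli.negOne,
    Pauli.op_negOne_mul, Pauli.op_negOne, neg_neg, Pauli.op_one]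

instance Pauli.finite : Finite (Pauli α) := by
  have h1 : Finite (Pauli.signs α).ker := by
    rw [Pauli.ker_signs]
    exact Nat.finite_of_card_ne_zero (by
      rw [Nat.card_zpowers]
      exact (orderOf_pos_iff.mpr (isOfFinOrder_iff_pow_eq_one.mpr
        ⟨4, by norm_num, Pauli.iI_pow_four⟩)).ne')
  have h2 : Finite (Pauli α ⧸ (Pauli.signs α).ker) :=
    Finite.of_injective _ (QuotientGroup.kerLift_injective (Pauli.signs α))
  exact Finite.of_subgroup_quotient (H := (Pauli.signs α).ker)

/-- `2m` Pauli operators on `m` qubits whose commutation relations are those of `m` pairs of a bit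
flip and a phase flip generate the Pauli group up to phases: a Pauli operator commuting with all of
them is a phase. The signs with the given operators take all `2 ^ (2m)` values, those with the
standard generators at most as many, and a phase has trivial signs, so both joint kernels agree. -/
lemma Pauli.mem_zpowers_iI_of_symplectic (b : α ⊕ α → Pauli α)
    (hb : ∀ i j, Commute (b i) (b j) ↔ j ≠ i.swap) {w : Pauli α} (hw : ∀ i, Commute w (b i)) :
    w ∈ Subgroup.zpowers (Pauli.iI α) := by
  let f : Pauli α →* (α ⊕ α → ℤˣ) := MonoidHom.pi fun j => Pauli.commSign (b j)
  have hle : (Pauli.signs α).ker ≤ f.ker := by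
    intro g hg
    rw [Pauli.ker_signs] at hg
    rw [MonoidHom.mem_ker]
    funext j
    exact Pauli.commSign_eq_one.mpr (Pauli.commute_of_mem_zpowers_iI hg _)
  have hsurj : Function.Surjective f := by
    have h1 : ∀ i, f (b i) = Pi.mulSingle i.swap (-1) := by
      intro i
      funext j
      by_cases hj : j = i.swap
      · subst hj
        rw [Pi.mulSingle_eq_same]
        exact Pauli.commSign_of_anticommute fun H => (hb _ _).mp H rfl
      · rw [Pi.mulSingle_eq_of_ne hj]
        exact Pauli.commSign_eq_one.mpr ((hb _ _).mpr hj)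
    intro v
    have h2 : v = ∏ i, Pi.mulSingle i (v i) := (Finset.univ_prod_mulSingle v).symm
    rw [← MonoidHom.mem_range, h2]
    refine Subgroup.prod_mem _ fun i _ => ?_
    rcases Int.units_eq_one_or (v i) with h | h
    · rw [h, Pi.mulSingle_one]; exact one_mem _
    · rw [h]; exact ⟨b i.swap, by rw [h1, Sum.swap_swap]⟩
  have hidx : (Pauli.signs α).ker = f.ker := by
    refine le_antisymm hle ?_
    have h1 : f.ker.index = Nat.card (α ⊕ α → ℤˣ) := by
      rw [Subgroup.index_ker, MonoidHom.range_eq_top.mpr hsurj, Subgroup.card_top]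
    have h2 : (Pauli.signs α).ker.index ≤ Nat.card (α ⊕ α → ℤˣ) := by
      rw [Subgroup.index_ker]
      exact Subgroup.card_le_card_group _
    rw [← h1, ← Subgroup.relIndex_mul_index hle] at h2
    rw [← Subgroup.relIndex_eq_one]
    have h3 : 0 < f.ker.index := by rw [h1]; exact Nat.card_pos
    have h4 : (Pauli.signs α).ker.relIndex f.ker ≠ 0 := Subgroup.index_ne_zero_of_finite
    have h5 : (Pauli.signs α).ker.relIndex f.ker ≤ 1 :=
      le_of_mul_le_mul_right (by simpa using h2) h3
    omega
  rw [← Pauli.ker_signs, hidx, MonoidHom.mem_ker]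
  funext j
  exact Pauli.commSign_eq_one.mpr (hw j)

end PauliGroup
end EAOAQEC

namespace EAOAQEC

/-! ### Matrices of orthogonal projections -/

section Projector

variable {α : Type} [Fintype α] [DecidableEq α]

/-- A matrix as an operator on the Hilbert space of the qubits. -/
local notation "act" => Matrix.toEuclideanCLM (n := α → Fin 2) (𝕜 := ℂ)

lemma act_projector (K : Submodule ℂ (QubitSpace α)) :
    act (projector K) = K.starProjection := by
  rw [projector, StarAlgEquiv.apply_symm_apply]

lemma act_inj {M N : Op α} : act M = act N ↔ M = N := EmbeddingLike.apply_eq_iff_eq _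

lemma act_mul_apply (M N : Op α) (ψ : QubitSpace α) : act (M * N) ψ = act M (act N ψ) := by
  rw [map_mul]
  rfl

lemma projector_mul_self (K : Submodule ℂ (QubitSpace α)) :
    projector K * projector K = projector K := by
  rw [projector, ← map_mul]
  congr 1
  exact K.isIdempotentElem_starProjection

lemma projector_star (K : Submodule ℂ (QubitSpace α)) : star (projector K) = projector K := by
  rw [← act_inj, map_star, act_projector]
  exact isSelfAdjoint_starProjection K

lemma projector_conjTranspose (K : Submodule ℂ (QubitSpace α)) :
    (projector K)ᴴ = projector K := projector_star K

lemma mul_projector_eq_iff {K : Submodule ℂ (QubitSpace α)} {M N : Op α} :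
    M * projector K = N * projector K ↔ ∀ ψ ∈ K, act M ψ = act N ψ := by
  rw [← act_inj, ContinuousLinearMap.ext_iff]
  simp only [act_mul_apply, act_projector]
  constructor
  · intro h ψ hψ
    simpa [Submodule.starProjection_eq_self_iff.mpr hψ] using h ψ
  · intro h ψ
    exact h _ (Submodule.starProjection_apply_mem K ψ)

lemma projector_mul_eq_self_iff {K : Submodule ℂ (QubitSpace α)} {M : Op α} :
    projector K * M = M ↔ ∀ ψ, act M ψ ∈ K := by
  rw [← act_inj, ContinuousLinearMap.ext_iff]
  simp only [act_mul_apply, act_projector, Submodule.starProjection_eq_self_iff]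

end Projector

/-! ### The stabilizer projection as a group average -/

section Average

variable {α : Type} [Fintype α] [DecidableEq α]

/-- The group average of a Pauli subgroup. -/
noncomputable def average (K : Subgroup (Pauli α)) : Op α :=
  (Nat.card K : ℂ)⁻¹ • ∑ᶠ g : K, (g : Pauli α).op

lemma mul_average {K : Subgroup (Pauli α)} {g : Pauli α} (hg : g ∈ K) :
    g.op * average K = average K := by
  have := Fintype.ofFinite K
  rw [average, Matrix.mul_smul, finsum_eq_sum_of_fintype, Finset.mul_sum]
  congr 1
  exact Fintype.sum_equiv (Equiv.mulLeft (⟨g, hg⟩ : K)) _ _ fun x => rfl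

lemma average_conjTranspose (K : Subgroup (Pauli α)) : (average K)ᴴ = average K := by
  have := Fintype.ofFinite K
  rw [average, Matrix.conjTranspose_smul, finsum_eq_sum_of_fintype, Matrix.conjTranspose_sum]
  congr 1
  · simp
  · exact Fintype.sum_equiv (Equiv.inv K) _ _ fun x => rfl

lemma projector_stabilizerSpace_eq_average (K : Subgroup (Pauli α)) :
    projector (stabilizerSpace (K : Set (Pauli α))) = average K := by
  have h1 : projector (stabilizerSpace (K : Set (Pauli α))) * average K = average K := by
    rw [projector_mul_eq_self_iff]
    intro ψ g hg
    rw [← act_mul_apply, mul_average hg]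
  have h2 : average K * projector (stabilizerSpace (K : Set (Pauli α))) =
      projector (stabilizerSpace (K : Set (Pauli α))) := by
    have := Fintype.ofFinite K
    rw [average, finsum_eq_sum_of_fintype, Matrix.smul_mul, Finset.sum_mul]
    have h3 : ∀ g : K, (g : Pauli α).op * projector (stabilizerSpace (K : Set (Pauli α))) =
        projector (stabilizerSpace (K : Set (Pauli α))) := by
      intro g
      rw [← one_mul (projector _), ← mul_assoc, mul_one, mul_projector_eq_iff]
      intro ψ hψ
      simpa using hψ g g.2
    rw [Finset.sum_congr rfl fun g _ => h3 g, Finset.sum_const, Finset.card_univ,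
      ← Nat.card_eq_fintype_card, ← Nat.cast_smul_eq_nsmul ℂ, smul_smul,
      inv_mul_cancel₀ (Nat.cast_ne_zero.mpr Nat.card_pos.ne'), one_smul]
  rw [← h1, ← projector_conjTranspose, ← average_conjTranspose, ← Matrix.conjTranspose_mul, h2]

/-- Only the elements of `g K` that are scalars contribute to the trace of `g` times the average
of `K`. -/
lemma trace_mul_average_eq_zero {K : Subgroup (Pauli α)} {g : Pauli α}
    (h : ∀ s ∈ K, g * s ∉ Subgroup.zpowers (Pauli.iI α)) : (g.op * average K).trace = 0 := by
  have := Fintype.ofFinite K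
  rw [average, Matrix.mul_smul, Matrix.trace_smul, finsum_eq_sum_of_fintype, Finset.mul_sum,
    Matrix.trace_sum, Finset.sum_eq_zero, smul_zero]
  intro s _
  rw [← Pauli.op_mul]
  exact Pauli.trace_op_eq_zero (h s s.2)

lemma eq_one_or_negOne_mem {K : Subgroup (Pauli α)} {g : Pauli α} (hg : g ∈ K)
    (h : g ∈ Subgroup.zpowers (Pauli.iI α)) : g = 1 ∨ Pauli.negOne α ∈ K := by
  obtain ⟨c, hc⟩ := Pauli.op_of_mem_zpowers_iI h
  rcases Pauli.mul_self_eq g with h1 | h1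
  · have h2 := congrFun (congrFun (congrArg Pauli.op h1) 0) 0
    rw [Pauli.op_mul, hc, Pauli.op_one] at h2
    simp at h2
    rcases mul_self_eq_one_iff.mp h2 with rfl | rfl
    · left
      apply Pauli.op_injective
      rw [hc, one_smul, Pauli.op_one]
    · right
      have : g = Pauli.negOne α := by
        apply Pauli.op_injective
        rw [hc, Pauli.op_negOne, neg_smul, one_smul]
      rwa [← this]
  · right
    rw [← h1]
    exact mul_mem hg hg

lemma average_ne_zero {K : Subgroup (Pauli α)} (hK : Pauli.negOne α ∉ K) : average K ≠ 0 := by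
  intro h
  have := Fintype.ofFinite K
  have h1 := congrArg Matrix.trace h
  rw [average, Matrix.trace_smul, finsum_eq_sum_of_fintype, Matrix.trace_sum,
    Finset.sum_eq_single (1 : K)] at h1
  · rw [OneMemClass.coe_one, Pauli.op_one, Matrix.trace_one, Matrix.trace_zero] at h1
    simp at h1
  · intro s _ hs
    refine Pauli.trace_op_eq_zero fun hs' => ?_
    rcases eq_one_or_negOne_mem s.2 hs' with h2 | h2
    · exact hs (Subtype.ext h2)
    · exact hK h2
  · simp

end Average

/-! ### Operators on Alice's and Bob's qubits -/

section Tensor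

variable {α β : Type} [Fintype α] [DecidableEq α] [Fintype β] [DecidableEq β]

lemma Pauli.tensor_one_injective :
    Function.Injective fun g : Pauli α => Pauli.tensor (g, (1 : Pauli β)) := by
  intro g h H
  apply Pauli.op_injective
  ext x y
  have h1 := congrFun (congrFun (congrArg Pauli.op H) (Sum.elim x 0)) (Sum.elim y 0)
  simpa [Pauli.op_tensor, tensorOp, Pauli.op_one, Equiv.sumArrowEquivProdArrow] using h1

lemma Pauli.one_tensor_injective :
    Function.Injective fun g : Pauli β => Pauli.tensor ((1 : Pauli α), g) := by
  intro g h H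
  apply Pauli.op_injective
  ext x y
  have h1 := congrFun (congrFun (congrArg Pauli.op H) (Sum.elim 0 x)) (Sum.elim 0 y)
  simpa [Pauli.op_tensor, tensorOp, Pauli.op_one, Equiv.sumArrowEquivProdArrow] using h1

/-- The embedding `g ↦ g ⊗ I` of Alice's Pauli group. -/
noncomputable def Pauli.inl (α β : Type) [Fintype α] [DecidableEq α] [Fintype β] [DecidableEq β] :
    Pauli α →* Pauli (α ⊕ β) :=
  Pauli.tensor.comp (MonoidHom.inl _ _)

lemma Pauli.inl_apply (g : Pauli α) : Pauli.inl α β g = Pauli.tensor (g, 1) := rfl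

lemma Pauli.inl_injective : Function.Injective (Pauli.inl α β) := Pauli.tensor_one_injective

lemma Pauli.inl_iI : Pauli.inl α β (Pauli.iI α) = Pauli.iI (α ⊕ β) := by
  apply Pauli.op_injective
  ext x y
  rw [Pauli.inl_apply, Pauli.op_tensor, Pauli.op_one, Pauli.op_iI, Pauli.op_iI,
    ← tensorOp_one (α := α) (β := β)]
  exact mul_assoc _ _ _

lemma Pauli.one_tensor_iI : Pauli.tensor ((1 : Pauli α), Pauli.iI β) = Pauli.iI (α ⊕ β) := by
  apply Pauli.op_injective
  ext x y
  rw [Pauli.op_tensor, Pauli.op_one, Pauli.op_iI, Pauli.op_iI,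
    ← tensorOp_one (α := α) (β := β)]
  exact mul_left_comm _ _ _

lemma Pauli.tensor_eq_mul (g : Pauli α) (h : Pauli β) :
    Pauli.tensor (g, h) = Pauli.inl α β g * Pauli.tensor (1, h) := by
  rw [Pauli.inl_apply, ← map_mul, Prod.mk_mul_mk, mul_one, one_mul]

lemma Pauli.one_tensor_mem_zpowers_iI {φ : Pauli β} (hφ : φ ∈ Subgroup.zpowers (Pauli.iI β)) :
    Pauli.tensor ((1 : Pauli α), φ) ∈ Subgroup.zpowers (Pauli.iI (α ⊕ β)) := by
  obtain ⟨k, rfl⟩ := hφ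
  have h := map_zpow (Pauli.tensor.comp (MonoidHom.inr (Pauli α) (Pauli β))) (Pauli.iI β) k
  refine ⟨k, ?_⟩
  change Pauli.iI (α ⊕ β) ^ k = _
  rw [← Pauli.one_tensor_iI]
  exact h.symm

lemma Pauli.commute_tensor_iff {g g' : Pauli α} {b b' : Pauli β}
    (h : Commute (Pauli.tensor (g, b)) (Pauli.tensor (g', b'))) :
    Commute g g' ↔ Commute b b' := by
  have h1 : Pauli.tensor (g * g', b * b') = Pauli.tensor (g' * g, b' * b) := by
    rw [← Prod.mk_mul_mk, map_mul, h.eq, ← map_mul, Prod.mk_mul_mk]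
  constructor
  · intro h2
    rw [h2.eq, Pauli.tensor_eq_mul, Pauli.tensor_eq_mul (g' * g), mul_left_cancel_iff] at h1
    exact Pauli.one_tensor_injective h1
  · intro h2
    rw [h2.eq, Pauli.tensor_eq_mul, Pauli.tensor_eq_mul (g' * g), mul_right_cancel_iff] at h1
    exact Pauli.inl_injective h1

lemma Pauli.commute_inl_tensor_iff {g g' : Pauli α} {b : Pauli β} :
    Commute (Pauli.inl α β g) (Pauli.tensor (g', b)) ↔ Commute g g' := by
  constructor
  · intro h
    exact (Pauli.commute_tensor_iff h).mpr (Commute.one_left b)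
  · intro h
    change _ * _ = _ * _
    rw [Pauli.inl_apply, ← map_mul, ← map_mul, Prod.mk_mul_mk, Prod.mk_mul_mk, h.eq, one_mul,
      mul_one]

end Tensor

/-! ### Stabilizer, normalizer and isotropic subgroup -/

namespace ExtendedSubgroup

variable {n e s : ℕ} (D : ExtendedSubgroup n e s)

/-- The generator `h ⊗ b` of `S` that extends a generator `h` of `H`. -/
noncomputable def extGen (i : GenIndex e s) : Pauli (Fin n ⊕ Fin e) :=
  Pauli.tensor (D.gen i, D.bob i)

lemma S_eq : D.S = Subgroup.closure (Set.range D.extGen) := rfl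

lemma extGen_mem (i : GenIndex e s) : D.extGen i ∈ D.S := Subgroup.subset_closure ⟨i, rfl⟩

variable {D}

lemma negOne_notMem : Pauli.negOne (Fin n ⊕ Fin e) ∉ D.S :=
  fun h => D.neg_one_notMem _ h Pauli.op_negOne

lemma S_commute {g h : Pauli (Fin n ⊕ Fin e)} (hg : g ∈ D.S) (hh : h ∈ D.S) : Commute g h := by
  have h1 : D.S ≤ Subgroup.centralizer D.S := by
    rw [S_eq, Subgroup.centralizer_closure, Subgroup.closure_le]
    rintro _ ⟨i, rfl⟩
    rw [SetLike.mem_coe, Subgroup.mem_centralizer_iff]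
    rintro _ ⟨j, rfl⟩
    exact D.ext_comm j i
  exact (Subgroup.mem_centralizer_iff.mp (h1 hg) h hh).symm

/-- Since `-I` is not in `S`, the normalizer of `S` is its centralizer. -/
lemma mem_NS_iff {g : Pauli (Fin n ⊕ Fin e)} : g ∈ D.NS ↔ ∀ t ∈ D.S, Commute g t := by
  rw [NS, Subgroup.mem_normalizer_iff]
  constructor
  · intro h t ht
    refine (Pauli.commute_or_anticommute g t).resolve_right fun h1 => ?_
    have h2 : g * t * g⁻¹ ∈ D.S := (h t).mp ht
    rw [h1, mul_assoc, mul_inv_cancel_right] at h2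
    exact negOne_notMem ((Subgroup.mul_mem_cancel_right _ ht).mp h2)
  · intro h t
    constructor
    · intro ht
      rw [(h t ht).eq, mul_inv_cancel_right]
      exact ht
    · intro ht
      have h1 := h _ ht
      have h2 : t = g⁻¹ * (g * t * g⁻¹) * g := by group
      rw [h2, h1.inv_left.eq, inv_mul_cancel_right]
      exact ht

lemma mem_NS_iff_extGen {g : Pauli (Fin n ⊕ Fin e)} :
    g ∈ D.NS ↔ ∀ i, Commute g (D.extGen i) := by
  rw [mem_NS_iff]
  refine ⟨fun h i => h _ (D.extGen_mem i), fun h => ?_⟩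
  have h1 : g ∈ Subgroup.centralizer (D.S : Set (Pauli (Fin n ⊕ Fin e))) := by
    rw [S_eq, Subgroup.centralizer_closure, Subgroup.mem_centralizer_iff]
    rintro _ ⟨i, rfl⟩
    exact (h i).symm.eq
  exact fun t ht => (Subgroup.mem_centralizer_iff.mp h1 t ht).symm

lemma inl_mem_NS_iff {g : Pauli (Fin n)} :
    Pauli.inl (Fin n) (Fin e) g ∈ D.NS ↔
      g ∈ Subgroup.centralizer (D.H : Set (Pauli (Fin n))) := by
  rw [mem_NS_iff_extGen, H, Subgroup.centralizer_closure, Subgroup.mem_centralizer_iff]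
  simp only [extGen, Pauli.commute_inl_tensor_iff, Set.forall_mem_range]
  exact forall_congr' fun i => ⟨fun h => h.symm, fun h => h.symm⟩

/-! ### The code space projection -/

lemma P_eq_average : D.P = average D.S := projector_stabilizerSpace_eq_average D.S

lemma P_mul_self : D.P * D.P = D.P := projector_mul_self _

lemma P_conjTranspose : (D.P)ᴴ = D.P := projector_conjTranspose _

lemma P_ne_zero : D.P ≠ 0 := by
  rw [P_eq_average]
  exact average_ne_zero negOne_notMem

lemma op_mul_P {g : Pauli (Fin n ⊕ Fin e)} (hg : g ∈ D.S) : g.op * D.P = D.P := by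
  rw [P_eq_average, mul_average hg]

lemma P_mul_op {g : Pauli (Fin n ⊕ Fin e)} (hg : g ∈ D.S) : D.P * g.op = D.P := by
  have h := congrArg Matrix.conjTranspose (op_mul_P (inv_mem hg))
  rwa [Matrix.conjTranspose_mul, P_conjTranspose, Pauli.op_inv,
    Matrix.conjTranspose_conjTranspose] at h

lemma op_mul_P_ne_zero (g : Pauli (Fin n ⊕ Fin e)) : g.op * D.P ≠ 0 := by
  intro h
  apply P_ne_zero (D := D)
  rw [← one_mul D.P, ← g.op_inv_mul_op, mul_assoc, h, mul_zero]

lemma P_comm_op {g : Pauli (Fin n ⊕ Fin e)} (hg : g ∈ D.NS) : D.P * g.op = g.op * D.P := by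
  have := Fintype.ofFinite D.S
  rw [P_eq_average, average, finsum_eq_sum_of_fintype, Matrix.mul_smul, Matrix.smul_mul,
    Finset.sum_mul, Finset.mul_sum]
  congr 1
  exact Finset.sum_congr rfl fun t _ =>
    congrArg Pauli.op (mem_NS_iff.mp hg t t.2).symm.eq

lemma P_mul_op_mul_P {g : Pauli (Fin n ⊕ Fin e)} (hg : g ∉ D.NS) : D.P * g.op * D.P = 0 := by
  rw [mem_NS_iff] at hg
  push Not at hg
  obtain ⟨t, ht, htg⟩ := hg
  have h1 := congrArg Pauli.op ((Pauli.commute_or_anticommute g t).resolve_left htg)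
  rw [Pauli.op_negOne_mul, Pauli.op_mul, Pauli.op_mul] at h1
  have h2 : D.P * g.op * D.P = -(D.P * g.op * D.P) := by
    calc D.P * g.op * D.P = D.P * (g.op * t.op) * D.P := by
          rw [mul_assoc, mul_assoc D.P, mul_assoc g.op, op_mul_P ht]
      _ = -(D.P * g.op * D.P) := by
          rw [h1, mul_neg, ← mul_assoc, P_mul_op ht, neg_mul]
  exact Matrix.ext fun i j => self_eq_neg.mp (congrFun (congrFun h2 i) j)

open scoped ComplexOrder in
/-- A Pauli operator that acts as a scalar on the code space lies in `S` up to a phase. -/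
lemma mem_of_op_mul_P_eq_smul {g : Pauli (Fin n ⊕ Fin e)} {c : ℂ} (h : g.op * D.P = c • D.P) :
    ∃ t ∈ D.S, g * t ∈ Subgroup.zpowers (Pauli.iI (Fin n ⊕ Fin e)) := by
  by_contra! H
  have h1 := trace_mul_average_eq_zero H
  rw [← P_eq_average, h, Matrix.trace_smul, smul_eq_mul, mul_eq_zero] at h1
  rcases h1 with rfl | h1
  · exact op_mul_P_ne_zero (D := D) g (by rw [h, zero_smul])
  · have h2 := Matrix.trace_conjTranspose_mul_self_eq_zero_iff (A := D.P)
    rw [P_conjTranspose, P_mul_self] at h2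
    exact P_ne_zero (h2.mp h1)

/-! ### Bob's parts of the generators -/

lemma gen_commute_iff (i j : Fin e ⊕ Fin e) :
    Commute (D.gen (.inl i)) (D.gen (.inl j)) ↔ j ≠ i.swap := by
  have hanti : ∀ i : Fin e, ¬ Commute (D.gen (.inl (.inl i))) (D.gen (.inl (.inr i))) := by
    intro i h
    have h1 := D.gen_anticomm i
    rw [← Pauli.op_mul, ← Pauli.op_mul, ← Pauli.op_negOne_mul, h.eq] at h1
    exact Pauli.negOne_mul_ne _ (Pauli.op_injective h1).symm
  rcases i with i | i <;> rcases j with j | j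
  · simpa using D.gen_comm_Z i j
  · by_cases hij : i = j
    · subst hij; simpa using hanti i
    · simpa [Ne.symm hij] using D.gen_comm i j hij
  · by_cases hij : j = i
    · subst hij; simpa using fun h => hanti j h.symm
    · simpa [hij] using (D.gen_comm j i hij).symm
  · simpa using D.gen_comm_X i j

lemma bob_commute_iff (i j : Fin e ⊕ Fin e) :
    Commute (D.bob (.inl i)) (D.bob (.inl j)) ↔ j ≠ i.swap := by
  rw [← gen_commute_iff (D := D)]
  exact (Pauli.commute_tensor_iff (D.ext_comm _ _)).symm

/-- The isotropic generators act on Bob's qubits by phases. -/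
lemma bob_iso_mem (i : Fin s) : D.bob (.inr i) ∈ Subgroup.zpowers (Pauli.iI (Fin e)) :=
  Pauli.mem_zpowers_iI_of_symplectic (fun j => D.bob (.inl j)) bob_commute_iff fun j =>
    (Pauli.commute_tensor_iff (D.ext_comm _ _)).mp (D.gen_comm_iso i (.inl j))

lemma mul_self_eq_one {t : Pauli (Fin n ⊕ Fin e)} (ht : t ∈ D.S) : t * t = 1 :=
  t.mul_self_eq.resolve_right fun h => negOne_notMem (D := D) (h ▸ mul_mem ht ht)

/-- The homomorphism from `{1, -1}` that sends `-1` to an element of order at most two. -/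
def unitsHom {G : Type*} [Group G] (g : G) (hg : g * g = 1) : ℤˣ →* G where
  toFun u := if u = 1 then 1 else g
  map_one' := rfl
  map_mul' u v := by
    rcases Int.units_eq_one_or u with rfl | rfl <;> rcases Int.units_eq_one_or v with rfl | rfl <;>
      simp [hg]

lemma unitsHom_mem {G : Type*} [Group G] {g : G} (hg : g * g = 1) (K : Subgroup G) (hK : g ∈ K)
    (u : ℤˣ) : unitsHom g hg u ∈ K := by
  change (if u = 1 then 1 else g) ∈ K
  split_ifs
  · exact one_mem K
  · exact hK

/-- The signs by which an operator commutes with Bob's parts of the symplectic generators. -/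
noncomputable def bobSigns (D : ExtendedSubgroup n e s) :
    Pauli (Fin n ⊕ Fin e) →* (Fin e ⊕ Fin e → ℤˣ) :=
  MonoidHom.pi fun j => Pauli.commSign (Pauli.tensor (1, D.bob (.inl j)))

section SignedProduct

variable {G ι : Type*} [Group G] [Fintype ι] (g : ι → G) (hg : ∀ i, g i * g i = 1)
  (hcomm : ∀ i j, Commute (g i) (g j))

/-- The product of those members of a commuting family of elements of order at most two at which
a pattern of signs is negative, as a homomorphism. -/
noncomputable def signedProduct : (ι → ℤˣ) →* G :=
  MonoidHom.noncommPiCoprod (N := fun _ : ι => ℤˣ) (fun i => unitsHom (g i) (hg i))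
    fun i j _ u v => by
      change Commute (if u = 1 then 1 else g i) (if v = 1 then 1 else g j)
      split_ifs <;> simp [hcomm]

lemma signedProduct_mulSingle [DecidableEq ι] (i : ι) (u : ℤˣ) :
    signedProduct g hg hcomm (Pi.mulSingle i u) = unitsHom (g i) (hg i) u := by
  unfold signedProduct
  exact MonoidHom.noncommPiCoprod_mulSingle (N := fun _ : ι => ℤˣ) _ i u

end SignedProduct

/-- The product of the symplectic generators of `S` with a prescribed pattern of signs. -/
noncomputable def ofSigns (D : ExtendedSubgroup n e s) :
    (Fin e ⊕ Fin e → ℤˣ) →* Pauli (Fin n ⊕ Fin e) :=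
  signedProduct (fun j => D.extGen (.inl j.swap)) (fun _ => mul_self_eq_one (D.extGen_mem _))
    fun _ _ => S_commute (D.extGen_mem _) (D.extGen_mem _)

lemma ofSigns_mulSingle (i : Fin e ⊕ Fin e) (u : ℤˣ) :
    D.ofSigns (Pi.mulSingle i u) =
      unitsHom (D.extGen (.inl i.swap)) (mul_self_eq_one (D.extGen_mem _)) u :=
  signedProduct_mulSingle _ _ _ i u

lemma ofSigns_mem (v : Fin e ⊕ Fin e → ℤˣ) : D.ofSigns v ∈ D.S := by
  rw [← Subgroup.mem_comap, ← Finset.univ_prod_mulSingle v]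
  refine Subgroup.prod_mem _ fun j _ => ?_
  rw [Subgroup.mem_comap, ofSigns_mulSingle]
  exact unitsHom_mem _ _ (D.extGen_mem _) _

lemma commute_one_tensor_iff (g : Pauli (Fin n)) (b c : Pauli (Fin e)) :
    Commute (Pauli.tensor (g, b)) (Pauli.tensor (1, c)) ↔ Commute b c := by
  constructor
  · intro h
    exact (Pauli.commute_tensor_iff h).mp (Commute.one_right g)
  · intro h
    change _ * _ = _ * _
    rw [← map_mul, ← map_mul, Prod.mk_mul_mk, Prod.mk_mul_mk, h.eq, one_mul, mul_one]

lemma bobSigns_extGen_inl (i : Fin e ⊕ Fin e) :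
    D.bobSigns (D.extGen (.inl i)) = Pi.mulSingle i.swap (-1) := by
  funext j
  by_cases hj : j = i.swap
  · subst hj
    rw [Pi.mulSingle_eq_same]
    exact Pauli.commSign_of_anticommute fun H =>
      (bob_commute_iff i i.swap).mp ((commute_one_tensor_iff _ _ _).mp H) rfl
  · rw [Pi.mulSingle_eq_of_ne hj]
    exact Pauli.commSign_eq_one.mpr
      ((commute_one_tensor_iff _ _ _).mpr ((bob_commute_iff i j).mpr hj))

lemma bobSigns_extGen_inr (i : Fin s) : D.bobSigns (D.extGen (.inr i)) = 1 := by
  funext j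
  exact Pauli.commSign_eq_one.mpr
    ((commute_one_tensor_iff _ _ _).mpr (Pauli.commute_of_mem_zpowers_iI (bob_iso_mem i) _))

lemma ofSigns_mulSingle_neg_one (i : Fin e ⊕ Fin e) :
    D.ofSigns (Pi.mulSingle i.swap (-1)) = D.extGen (.inl i) := by
  rw [ofSigns_mulSingle]
  change D.extGen (.inl i.swap.swap) = _
  rw [Sum.swap_swap]

/-- The subgroup of `S` generated by the extended isotropic generators. -/
noncomputable def SI (D : ExtendedSubgroup n e s) : Subgroup (Pauli (Fin n ⊕ Fin e)) :=
  Subgroup.closure (Set.range fun i : Fin s => D.extGen (.inr i))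

/-- An element of `S` is the product of the symplectic generators prescribed by its signs with an
element generated by the isotropic generators. -/
lemma exists_eq_ofSigns_mul {t : Pauli (Fin n ⊕ Fin e)} (ht : t ∈ D.S) :
    ∃ w ∈ D.SI, t = D.ofSigns (D.bobSigns t) * w := by
  have hle : D.SI ≤ D.S := (Subgroup.closure_le _).mpr (by
    rintro _ ⟨i, rfl⟩; exact D.extGen_mem _)
  rw [S_eq] at ht
  induction ht using Subgroup.closure_induction with
  | mem x hx =>
    obtain ⟨i | i, rfl⟩ := hx
    · exact ⟨1, one_mem _, by rw [bobSigns_extGen_inl, ofSigns_mulSingle_neg_one, mul_one]⟩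
    · exact ⟨_, Subgroup.subset_closure ⟨i, rfl⟩, by rw [bobSigns_extGen_inr, map_one, one_mul]⟩
  | one => exact ⟨1, one_mem _, by simp⟩
  | mul x y _ _ hx hy =>
    obtain ⟨w, hw, h1⟩ := hx
    obtain ⟨v, hv, h2⟩ := hy
    refine ⟨w * v, mul_mem hw hv, ?_⟩
    have h3 : Commute w (D.ofSigns (D.bobSigns y)) := S_commute (hle hw) (ofSigns_mem _)
    rw [map_mul, map_mul]
    conv_lhs => rw [h1, h2, mul_assoc, ← mul_assoc w, h3.eq]
    simp only [mul_assoc]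
  | inv x _ hx =>
    obtain ⟨w, hw, h1⟩ := hx
    refine ⟨w⁻¹, inv_mem hw, ?_⟩
    have h3 : Commute w (D.ofSigns (D.bobSigns x)) := S_commute (hle hw) (ofSigns_mem _)
    rw [map_inv, map_inv]
    conv_lhs => rw [h1, mul_inv_rev]
    exact h3.inv_inv.eq

lemma exists_inl_mul_of_mem_SI {w : Pauli (Fin n ⊕ Fin e)} (hw : w ∈ D.SI) :
    ∃ h ∈ D.HI, ∃ c ∈ Subgroup.zpowers (Pauli.iI (Fin n ⊕ Fin e)),
      w = Pauli.inl (Fin n) (Fin e) h * c := by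
  induction hw using Subgroup.closure_induction with
  | mem x hx =>
    obtain ⟨i, rfl⟩ := hx
    exact ⟨_, Subgroup.subset_closure ⟨i, rfl⟩, _,
      Pauli.one_tensor_mem_zpowers_iI (bob_iso_mem i), Pauli.tensor_eq_mul _ _⟩
  | one => exact ⟨1, one_mem _, 1, one_mem _, by simp⟩
  | mul x y _ _ hx hy =>
    obtain ⟨h, hh, c, hc, rfl⟩ := hx
    obtain ⟨h', hh', c', hc', rfl⟩ := hy
    refine ⟨h * h', mul_mem hh hh', c * c', mul_mem hc hc', ?_⟩
    have h1 := Pauli.commute_of_mem_zpowers_iI hc (Pauli.inl (Fin n) (Fin e) h')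
    rw [map_mul, mul_assoc, ← mul_assoc c, h1.eq]
    simp only [mul_assoc]
  | inv x _ hx =>
    obtain ⟨h, hh, c, hc, rfl⟩ := hx
    refine ⟨h⁻¹, inv_mem hh, c⁻¹, inv_mem hc, ?_⟩
    rw [mul_inv_rev, map_inv]
    exact (Pauli.commute_of_mem_zpowers_iI hc _).inv_inv.eq

/-- An element of `S` that acts as the identity on Bob's qubits comes from the isotropic
subgroup: the signs by which Bob's part commutes determine the exponents of the symplectic
generators, so all of these vanish. -/
lemma exists_inl_mul_of_inl_mem_S {g : Pauli (Fin n)}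
    (hg : Pauli.inl (Fin n) (Fin e) g ∈ D.S) :
    ∃ h ∈ D.HI, ∃ c ∈ Subgroup.zpowers (Pauli.iI (Fin n ⊕ Fin e)),
      Pauli.inl (Fin n) (Fin e) g = Pauli.inl (Fin n) (Fin e) h * c := by
  obtain ⟨w, hw, h1⟩ := exists_eq_ofSigns_mul hg
  have h2 : D.bobSigns (Pauli.inl (Fin n) (Fin e) g) = 1 := by
    funext j
    exact Pauli.commSign_eq_one.mpr
      ((commute_one_tensor_iff _ _ _).mpr (Commute.one_left _))
  rw [h2, map_one, one_mul] at h1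
  rw [h1]
  exact exists_inl_mul_of_mem_SI hw

end ExtendedSubgroup
end EAOAQEC

namespace EAOAQEC

/-! ### The gauge group and the logical algebra -/

lemma normal_of_negOne_mem {α : Type} [Fintype α] [DecidableEq α] {K : Subgroup (Pauli α)}
    (h : Pauli.negOne α ∈ K) : K.Normal where
  conj_mem x hx g := by
    rcases Pauli.commute_or_anticommute g x with h1 | h1
    · rwa [h1.eq, mul_inv_cancel_right]
    · rw [h1, mul_assoc, mul_inv_cancel_right]
      exact mul_mem h hx

namespace Code

open ExtendedSubgroup

variable {n e s r k : ℕ} (C : Code n e s r k)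

/-- The group generated by the stabilizer, the phases and the gauge operators. -/
noncomputable def gaugeGroup : Subgroup (Pauli (Fin n ⊕ Fin e)) :=
  Subgroup.closure ((C.S : Set (Pauli (Fin n ⊕ Fin e))) ∪ {Pauli.iI (Fin n ⊕ Fin e)} ∪ C.G₀)

/-- The isotropic subgroup, the phases and the gauge operators, on Alice's qubits. -/
noncomputable def aliceGaugeGroup : Subgroup (Pauli (Fin n)) :=
  Subgroup.closure ((C.HI : Set (Pauli (Fin n))) ∪ alice C.G₀ ∪ {Pauli.iI (Fin n)})

variable {C}

lemma iI_mem_gaugeGroup : Pauli.iI (Fin n ⊕ Fin e) ∈ C.gaugeGroup :=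
  Subgroup.subset_closure (.inl (.inr rfl))

lemma S_le_gaugeGroup : C.S ≤ C.gaugeGroup :=
  fun _ h => Subgroup.subset_closure (.inl (.inl h))

instance gaugeGroup_normal : C.gaugeGroup.Normal :=
  normal_of_negOne_mem (mul_mem iI_mem_gaugeGroup iI_mem_gaugeGroup)

lemma iI_mem_aliceGaugeGroup : Pauli.iI (Fin n) ∈ C.aliceGaugeGroup :=
  Subgroup.subset_closure (.inr rfl)

lemma NS_eq_sup : C.NS = C.gaugeGroup ⊔ Subgroup.closure C.L₀ := by
  rw [C.normalizer_eq, gaugeGroup, ← Subgroup.closure_union]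

lemma gaugeGroup_le_NS : C.gaugeGroup ≤ C.NS := NS_eq_sup (C := C) ▸ le_sup_left

lemma L₀_subset_NS {l : Pauli (Fin n ⊕ Fin e)} (hl : l ∈ C.L₀) : l ∈ C.NS := by
  rw [NS_eq_sup]
  exact (le_sup_right : Subgroup.closure C.L₀ ≤ _) (Subgroup.subset_closure hl)

lemma gaugeGroup_commute_L₀ {γ l : Pauli (Fin n ⊕ Fin e)} (hγ : γ ∈ C.gaugeGroup)
    (hl : l ∈ C.L₀) : Commute γ l := by
  have h : C.gaugeGroup ≤ Subgroup.centralizer {l} := by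
    rw [gaugeGroup, Subgroup.closure_le]
    rintro g ((hg | rfl) | hg) <;> rw [SetLike.mem_coe, Subgroup.mem_centralizer_singleton_iff]
    · exact (mem_NS_iff.mp (L₀_subset_NS hl) g hg).symm.eq
    · exact (Pauli.iI_comm l).eq
    · exact (C.gauge_logical_comm g hg l hl).eq
  exact Subgroup.mem_centralizer_singleton_iff.mp (h hγ)

lemma inl_mem_gaugeGroup {g : Pauli (Fin n)} (hg : g ∈ C.aliceGaugeGroup) :
    Pauli.inl (Fin n) (Fin e) g ∈ C.gaugeGroup := by
  have h1 : C.HI ≤ C.gaugeGroup.comap (Pauli.inl (Fin n) (Fin e)) := by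
    rw [HI, Subgroup.closure_le]
    rintro _ ⟨i, rfl⟩
    rw [SetLike.mem_coe, Subgroup.mem_comap]
    have h2 : Pauli.tensor (1, C.bob (.inr i)) ∈ C.gaugeGroup :=
      (Subgroup.zpowers_le.mpr iI_mem_gaugeGroup)
        (Pauli.one_tensor_mem_zpowers_iI (bob_iso_mem i))
    have h3 := S_le_gaugeGroup (C.extGen_mem (.inr i))
    rw [extGen, Pauli.tensor_eq_mul] at h3
    exact (Subgroup.mul_mem_cancel_right _ h2).mp h3
  have h4 : C.aliceGaugeGroup ≤ C.gaugeGroup.comap (Pauli.inl (Fin n) (Fin e)) := by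
    rw [aliceGaugeGroup, Subgroup.closure_le]
    rintro g ((hg | hg) | rfl)
    · exact h1 hg
    · exact Subgroup.subset_closure (.inr hg)
    · rw [SetLike.mem_coe, Subgroup.mem_comap, Pauli.inl_iI]
      exact iI_mem_gaugeGroup
  exact h4 hg

/-- The gauge group meets Alice's Pauli group in the group generated by the isotropic subgroup,
the phases and the gauge operators. -/
lemma mem_aliceGaugeGroup {g : Pauli (Fin n)}
    (hg : Pauli.inl (Fin n) (Fin e) g ∈ C.gaugeGroup) : g ∈ C.aliceGaugeGroup := by
  have hn : (C.aliceGaugeGroup.map (Pauli.inl (Fin n) (Fin e))).Normal := by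
    refine normal_of_negOne_mem ?_
    rw [Pauli.negOne, ← Pauli.inl_iI, ← map_mul]
    exact Subgroup.mem_map_of_mem _ (mul_mem iI_mem_aliceGaugeGroup iI_mem_aliceGaugeGroup)
  have hle : C.gaugeGroup ≤ C.S ⊔ C.aliceGaugeGroup.map (Pauli.inl (Fin n) (Fin e)) := by
    rw [gaugeGroup, Subgroup.closure_le]
    rintro x ((hx | rfl) | hx)
    · exact Subgroup.mem_sup_left hx
    · rw [← Pauli.inl_iI]
      exact Subgroup.mem_sup_right (Subgroup.mem_map_of_mem _ iI_mem_aliceGaugeGroup)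
    · obtain ⟨h, rfl⟩ := C.gauge_ext x hx
      exact Subgroup.mem_sup_right
        (Subgroup.mem_map_of_mem _ (Subgroup.subset_closure (.inl (.inr hx))))
  obtain ⟨t, ht, _, ⟨a, ha, rfl⟩, h1⟩ := Subgroup.mem_sup_of_normal_right.mp (hle hg)
  have h2 : t = Pauli.inl (Fin n) (Fin e) (g * a⁻¹) := by
    rw [map_mul, map_inv, ← h1, mul_inv_cancel_right]
  rw [h2] at ht
  obtain ⟨h, hh, c, ⟨m, hm⟩, h3⟩ := exists_inl_mul_of_inl_mem_S ht
  have h4 : g * a⁻¹ = h * Pauli.iI (Fin n) ^ m := by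
    apply Pauli.inl_injective (β := Fin e)
    rw [h3, map_mul, map_zpow, Pauli.inl_iI]
    exact congrArg _ hm.symm
  rw [eq_mul_of_mul_inv_eq h4]
  exact mul_mem (mul_mem (Subgroup.subset_closure (.inl (.inl hh)))
    (zpow_mem iI_mem_aliceGaugeGroup m)) ha

lemma op_mul_P_mem {l : Pauli (Fin n ⊕ Fin e)} (hl : l ∈ Subgroup.closure C.L₀) :
    l.op * C.P ∈ compressionAlgebra C.P C.L₀ := by
  have hNS : ∀ x ∈ Subgroup.closure C.L₀, x ∈ C.NS := fun x hx => by
    rw [NS_eq_sup]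
    exact Subgroup.mem_sup_right hx
  induction hl using Subgroup.closure_induction with
  | mem x hx => exact NonUnitalStarAlgebra.subset_adjoin ℂ _ (Or.inr ⟨x, hx, rfl⟩)
  | one =>
    rw [Pauli.op_one, one_mul]
    exact NonUnitalStarAlgebra.subset_adjoin ℂ _ (Or.inl rfl)
  | mul x y _ hy h1 h2 =>
    have h3 : (x * y).op * C.P = x.op * C.P * (y.op * C.P) := by
      rw [mul_assoc, ← mul_assoc C.P, P_comm_op (hNS y hy), mul_assoc, P_mul_self, Pauli.op_mul,
        mul_assoc]
    rw [h3]
    exact mul_mem h1 h2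
  | inv x hx h =>
    have h3 : (x⁻¹).op * C.P = star (x.op * C.P) := by
      rw [Matrix.star_eq_conjTranspose, Matrix.conjTranspose_mul, P_conjTranspose,
        ← Pauli.op_inv, P_comm_op (inv_mem (hNS x hx))]
    rw [h3]
    exact star_mem h

lemma P_mem : C.P ∈ compressionAlgebra C.P C.L₀ :=
  NonUnitalStarAlgebra.subset_adjoin ℂ _ (Or.inl rfl)

lemma P_mul_of_mem {Y : Op (Fin n ⊕ Fin e)} (hY : Y ∈ compressionAlgebra C.P C.L₀) :
    C.P * Y = Y ∧ Y * C.P = Y := by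
  induction hY using NonUnitalStarAlgebra.adjoin_induction with
  | mem x hx =>
    rcases hx with rfl | ⟨l, hl, rfl⟩
    · exact ⟨P_mul_self, P_mul_self⟩
    · rw [← mul_assoc, P_comm_op (L₀_subset_NS hl), mul_assoc, P_mul_self]
      exact ⟨rfl, rfl⟩
  | add x y _ _ hx hy => exact ⟨by rw [mul_add, hx.1, hy.1], by rw [add_mul, hx.2, hy.2]⟩
  | zero => simp
  | mul x y _ _ hx hy => exact ⟨by rw [← mul_assoc, hx.1], by rw [mul_assoc, hy.2]⟩
  | smul c x _ hx => exact ⟨by rw [Matrix.mul_smul, hx.1], by rw [Matrix.smul_mul, hx.2]⟩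
  | star x _ hx =>
    have h1 := congrArg star hx.1
    have h2 := congrArg star hx.2
    rw [star_mul, Matrix.star_eq_conjTranspose C.P, P_conjTranspose] at h1 h2
    exact ⟨h2, h1⟩

lemma commute_of_mem_compressionAlgebra {g : Pauli (Fin n ⊕ Fin e)} (hg : g ∈ C.NS)
    (hc : ∀ l ∈ C.L₀, Commute g l) {Y : Op (Fin n ⊕ Fin e)}
    (hY : Y ∈ compressionAlgebra C.P C.L₀) : Commute g.op Y := by
  have h1 : ∀ l ∈ C.L₀, Commute g.op l.op := fun l hl => congrArg Pauli.op (hc l hl)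
  have h2 : ∀ l ∈ C.L₀, Commute g.op (l.op)ᴴ :=
    fun l hl => congrArg Pauli.op (hc l hl).inv_right
  have hP : Commute g.op C.P := (P_comm_op hg).symm
  refine NonUnitalStarAlgebra.commute_of_mem_adjoin_of_forall_mem_commute hY ?_ ?_
  · rintro _ (rfl | ⟨l, hl, rfl⟩)
    · exact hP
    · exact (h1 l hl).mul_right hP
  · rintro _ (rfl | ⟨l, hl, rfl⟩)
    · rw [Matrix.star_eq_conjTranspose, P_conjTranspose]; exact hP
    · rw [Matrix.star_eq_conjTranspose, Matrix.conjTranspose_mul, P_conjTranspose]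
      exact hP.mul_right (h2 l hl)

lemma gaugeGroup_commute_of_mem {γ : Pauli (Fin n ⊕ Fin e)} (hγ : γ ∈ C.gaugeGroup)
    {Y : Op (Fin n ⊕ Fin e)} (hY : Y ∈ compressionAlgebra C.P C.L₀) : Commute γ.op Y :=
  commute_of_mem_compressionAlgebra (gaugeGroup_le_NS hγ)
    (fun _ hl => gaugeGroup_commute_L₀ hγ hl) hY

/-- The compressed logical operators generate a full matrix algebra, whose centre is trivial. -/
lemma eq_smul_P_of_central {M : Op (Fin n ⊕ Fin e)} (hM : M ∈ compressionAlgebra C.P C.L₀)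
    (hc : ∀ Y ∈ compressionAlgebra C.P C.L₀, M * Y = Y * M) : ∃ c : ℂ, M = c • C.P := by
  obtain ⟨φ⟩ := C.logical_algebra
  have hone : φ ⟨C.P, P_mem⟩ = 1 := by
    have h1 : (⟨C.P, P_mem⟩ : compressionAlgebra C.P C.L₀) * φ.symm 1 = φ.symm 1 :=
      Subtype.ext (P_mul_of_mem (φ.symm 1).2).1
    have h2 := congrArg φ h1
    rwa [map_mul, StarAlgEquiv.apply_symm_apply, mul_one] at h2
  have hcomm : ∀ B, Commute B (φ ⟨M, hM⟩) := by
    intro B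
    have h1 : (⟨M, hM⟩ : compressionAlgebra C.P C.L₀) * φ.symm B = φ.symm B * ⟨M, hM⟩ :=
      Subtype.ext (hc _ (φ.symm B).2)
    have h2 := congrArg φ h1
    rw [map_mul, map_mul, StarAlgEquiv.apply_symm_apply] at h2
    exact h2.symm
  obtain ⟨c, hc'⟩ := Matrix.mem_range_scalar_of_commute_single fun i j _ => hcomm _
  refine ⟨c, ?_⟩
  have h3 : (⟨M, hM⟩ : compressionAlgebra C.P C.L₀) = c • ⟨C.P, P_mem⟩ := by
    refine EquivLike.injective φ ?_
    rw [map_smul, hone, ← hc', Matrix.scalar_apply, Matrix.smul_one_eq_diagonal]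
  exact congrArg Subtype.val h3

/-- An element of the normalizer that commutes with the logical operators lies in the gauge
group: its logical part is central in the logical algebra, hence trivial. -/
lemma mem_gaugeGroup_of_commute {z : Pauli (Fin n ⊕ Fin e)} (hz : z ∈ C.NS)
    (hc : ∀ l ∈ C.L₀, Commute z l) : z ∈ C.gaugeGroup := by
  rw [NS_eq_sup] at hz
  obtain ⟨γ, hγ, l, hl, rfl⟩ := Subgroup.mem_sup_of_normal_left.mp hz
  have hlc : ∀ l' ∈ C.L₀, Commute l l' := fun l' hl' => by
    simpa using (gaugeGroup_commute_L₀ hγ hl').inv_left.mul_left (hc l' hl')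
  have hlNS : l ∈ C.NS := by rw [NS_eq_sup]; exact Subgroup.mem_sup_right hl
  obtain ⟨c, hc'⟩ := eq_smul_P_of_central (op_mul_P_mem hl) fun Y hY => by
    rw [mul_assoc, (P_mul_of_mem hY).1, ← mul_assoc Y,
      ← (commute_of_mem_compressionAlgebra hlNS hlc hY).eq, mul_assoc, (P_mul_of_mem hY).2]
  obtain ⟨t, ht, hlt⟩ := mem_of_op_mul_P_eq_smul hc'
  refine mul_mem hγ ((Subgroup.mul_mem_cancel_right _ (S_le_gaugeGroup ht)).mp ?_)
  exact (Subgroup.zpowers_le.mpr iI_mem_gaugeGroup) hlt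

/-! ### The sectors of the code space -/

lemma not_mem_NS_of_ne {T T' : Pauli (Fin n ⊕ Fin e)} (hT : T ∈ C.T₀) (hT' : T' ∈ C.T₀)
    (h : T ≠ T') : T⁻¹ * T' ∉ C.NS := by
  intro hmem
  obtain ⟨U, hU, hsub⟩ := C.T₀_transversal
  have h1 : ((⟨T, hsub hT⟩, ⟨T⁻¹ * T', hmem⟩) : U × (C.NS : Set (Pauli (Fin n ⊕ Fin e)))) =
      (⟨T', hsub hT'⟩, ⟨1, one_mem _⟩) := hU.1 (by simp)
  exact h (congrArg Subtype.val (congrArg Prod.fst h1))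

/-- Distinct sectors are orthogonal. -/
lemma P_mul_inv_mul_P {T T' : Pauli (Fin n ⊕ Fin e)} (hT : T ∈ C.T₀) (hT' : T' ∈ C.T₀)
    (h : T ≠ T') : C.P * (T⁻¹).op * (T'.op * C.P) = 0 := by
  rw [mul_assoc, ← mul_assoc (T⁻¹).op, ← Pauli.op_mul, ← mul_assoc]
  exact P_mul_op_mul_P (not_mem_NS_of_ne hT hT' h)

variable (C) in
/-- The projection onto the whole code space. -/
noncomputable def Q : Op (Fin n ⊕ Fin e) := projector C.hybridSpace

lemma Q_conjTranspose : (C.Q)ᴴ = C.Q := projector_conjTranspose _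

lemma mul_Q_ext {M N : Op (Fin n ⊕ Fin e)}
    (h : ∀ T ∈ C.T₀, M * (T.op * C.P) = N * (T.op * C.P)) : M * C.Q = N * C.Q := by
  rw [Q, mul_projector_eq_iff]
  have hle : C.hybridSpace ≤ LinearMap.eqLocus
      (Matrix.toEuclideanCLM (n := Fin n ⊕ Fin e → Fin 2) (𝕜 := ℂ) M).toLinearMap
      (Matrix.toEuclideanCLM (n := Fin n ⊕ Fin e → Fin 2) (𝕜 := ℂ) N).toLinearMap := by
    refine iSup₂_le fun T hT => ?_
    rintro _ ⟨ψ, hψ, rfl⟩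
    have h1 := h T hT
    rw [← mul_assoc, ← mul_assoc, P, mul_projector_eq_iff] at h1
    have h2 := h1 ψ hψ
    rwa [act_mul_apply, act_mul_apply] at h2
  exact fun ψ hψ => hle hψ

lemma Q_mul_sector {T : Pauli (Fin n ⊕ Fin e)} (hT : T ∈ C.T₀) :
    C.Q * (T.op * C.P) = T.op * C.P := by
  rw [Q, projector_mul_eq_self_iff]
  intro ψ
  rw [act_mul_apply, P, act_projector]
  exact (le_iSup₂ (f := fun T (_ : T ∈ C.T₀) => C.codeSpace.map
    (Matrix.toEuclideanCLM (n := Fin n ⊕ Fin e → Fin 2) (𝕜 := ℂ) T.op).toLinearMap) T hT)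
    ⟨_, Submodule.starProjection_apply_mem _ ψ, rfl⟩

lemma Q_mul_P : C.Q * C.P = C.P := by
  have h := Q_mul_sector C.one_mem_T₀
  rwa [Pauli.op_one, one_mul] at h

lemma P_mul_Q : C.P * C.Q = C.P := by
  have h := congrArg Matrix.conjTranspose (Q_mul_P (C := C))
  rwa [Matrix.conjTranspose_mul, P_conjTranspose, Q_conjTranspose] at h

variable (C) in
/-- The observables `T Y T†` of the individual sectors, with `Y` in the logical algebra of the base
code space. They span the encoded algebra. -/
def sectorObservables : Set (Op (Fin n ⊕ Fin e)) :=
  {X | ∃ T ∈ C.T₀, ∃ Y ∈ compressionAlgebra C.P C.L₀, X = T.op * Y * (T.op)ᴴ}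

lemma logicalAlgebra_eq : C.logicalAlgebra = Submodule.span ℂ C.sectorObservables := rfl

lemma star_mem_sectorObservables {X : Op (Fin n ⊕ Fin e)} (hX : X ∈ C.sectorObservables) :
    Xᴴ ∈ C.sectorObservables := by
  obtain ⟨T, hT, Y, hY, rfl⟩ := hX
  refine ⟨T, hT, star Y, star_mem hY, ?_⟩
  simp only [Matrix.conjTranspose_mul, Matrix.conjTranspose_conjTranspose, mul_assoc,
    Matrix.star_eq_conjTranspose]

lemma star_mul_self_mem_sectorObservables {X : Op (Fin n ⊕ Fin e)}
    (hX : X ∈ C.sectorObservables) : Xᴴ * X ∈ C.sectorObservables := by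
  obtain ⟨T, hT, Y, hY, rfl⟩ := hX
  refine ⟨T, hT, star Y * Y, mul_mem (star_mem hY) hY, ?_⟩
  simp only [Matrix.conjTranspose_mul, Matrix.conjTranspose_conjTranspose,
    Matrix.star_eq_conjTranspose]
  have h : (T.op)ᴴ * T.op = 1 := T.op_inv_mul_op
  simp only [mul_assoc]
  rw [← mul_assoc (T.op)ᴴ T.op, h, one_mul]

lemma Q_mul_of_mem_sectorObservables {X : Op (Fin n ⊕ Fin e)} (hX : X ∈ C.sectorObservables) :
    C.Q * X = X := by
  obtain ⟨T, hT, Y, hY, rfl⟩ := hX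
  have h : C.Q * (T.op * C.P * Y * (T.op)ᴴ) = T.op * C.P * Y * (T.op)ᴴ := by
    rw [← mul_assoc, ← mul_assoc, Q_mul_sector hT]
  rwa [mul_assoc T.op, (P_mul_of_mem hY).1] at h

lemma mul_Q_of_mem_sectorObservables {X : Op (Fin n ⊕ Fin e)} (hX : X ∈ C.sectorObservables) :
    X * C.Q = X := by
  have h := congrArg Matrix.conjTranspose
    (Q_mul_of_mem_sectorObservables (star_mem_sectorObservables hX))
  rwa [Matrix.conjTranspose_mul, Q_conjTranspose, Matrix.conjTranspose_conjTranspose] at h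

lemma gaugeGroup_commute_sectorObservables {γ : Pauli (Fin n ⊕ Fin e)} (hγ : γ ∈ C.gaugeGroup)
    {X : Op (Fin n ⊕ Fin e)} (hX : X ∈ C.sectorObservables) : γ.op * X = X * γ.op := by
  obtain ⟨T, hT, Y, hY, rfl⟩ := hX
  have h1 : T⁻¹ * γ * T ∈ C.gaugeGroup := by
    simpa using gaugeGroup_normal.conj_mem γ hγ T⁻¹
  have h2 : γ.op * T.op = T.op * (T⁻¹ * γ * T).op := by
    rw [← Pauli.op_mul, ← Pauli.op_mul]; congr 1; group
  have h3 : (T⁻¹ * γ * T).op * (T.op)ᴴ = (T.op)ᴴ * γ.op := by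
    rw [← Pauli.op_inv, ← Pauli.op_mul, ← Pauli.op_mul]; congr 1; group
  rw [← mul_assoc, ← mul_assoc, h2, mul_assoc T.op, (gaugeGroup_commute_of_mem h1 hY).eq,
    mul_assoc, mul_assoc, h3]
  simp only [mul_assoc]

/-- The observables of a sector preserve each sector. -/
lemma exists_mul_sector {T : Pauli (Fin n ⊕ Fin e)} (hT : T ∈ C.T₀)
    {X : Op (Fin n ⊕ Fin e)} (hX : X ∈ C.sectorObservables) :
    ∃ Y, X * (T.op * C.P) = T.op * C.P * Y := by
  obtain ⟨T', hT', Y, hY, rfl⟩ := hX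
  by_cases h : T' = T
  · subst h
    refine ⟨Y, ?_⟩
    rw [mul_assoc, mul_assoc, ← mul_assoc (T'.op)ᴴ, ← Pauli.op_inv, Pauli.op_inv_mul_op, one_mul,
      (P_mul_of_mem hY).2, mul_assoc, (P_mul_of_mem hY).1]
  · refine ⟨0, ?_⟩
    have h1 : T'.op * (Y * C.P) * (T'⁻¹).op * (T.op * C.P) =
        T'.op * Y * (C.P * (T'⁻¹).op * (T.op * C.P)) := by simp only [mul_assoc]
    rw [← (P_mul_of_mem hY).2, ← Pauli.op_inv, mul_zero, h1, P_mul_inv_mul_P hT' hT h, mul_zero]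

end Code
end EAOAQEC

namespace EAOAQEC

/-! ### Necessity of the condition -/

open scoped ComplexOrder in
lemma eq_zero_of_sum_conjTranspose_mul_self {ι m : Type*} [Fintype ι] [Fintype m]
    [DecidableEq m] {D : ι → Matrix m m ℂ} (h : ∑ i, (D i)ᴴ * D i = 0) (i : ι) : D i = 0 := by
  have h1 := congrArg Matrix.trace h
  rw [Matrix.trace_sum, Matrix.trace_zero, Finset.sum_eq_zero_iff_of_nonneg
    fun i _ => (Matrix.posSemidef_conjTranspose_mul_self (D i)).trace_nonneg] at h1
  exact Matrix.trace_conjTranspose_mul_self_eq_zero_iff.mp (h1 i (Finset.mem_univ i))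

/-- If a channel with Kraus operators `K i` preserves the observables `X`, `X†` and `X† X` in the
Heisenberg picture, then `X` commutes with the Kraus operators on the range of `Q`: the sum of
`D† D` over the commutators `D` vanishes. -/
lemma comm_kraus_of_preserves {ι m : Type*} [Fintype ι] [Fintype m] [DecidableEq m]
    {K : ι → Matrix m m ℂ} (hK : ∑ i, (K i)ᴴ * K i = 1) {Q X : Matrix m m ℂ} (hQ : Qᴴ = Q)
    (hQX : Q * X = X) (h1 : Q * (∑ i, (K i)ᴴ * X * K i) * Q = X)
    (h2 : Q * (∑ i, (K i)ᴴ * Xᴴ * K i) * Q = Xᴴ)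
    (h3 : Q * (∑ i, (K i)ᴴ * (Xᴴ * X) * K i) * Q = Xᴴ * X) (i : ι) :
    X * (K i * Q) = K i * X := by
  have hXQ' : Xᴴ * Q = Xᴴ := by
    have h := congrArg Matrix.conjTranspose hQX
    rwa [Matrix.conjTranspose_mul, hQ] at h
  have h1' : Xᴴ * (∑ i, (K i)ᴴ * X * K i) * Q = Xᴴ * X := by
    rw [← hXQ', mul_assoc, mul_assoc, ← mul_assoc Q, h1, hXQ']
  have h2' : Q * (∑ i, (K i)ᴴ * Xᴴ * K i) * X = Xᴴ * X := by
    nth_rw 2 [← hQX]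
    rw [← mul_assoc, h2]
  have key : ∑ j, (X * (K j * Q) - K j * X)ᴴ * (X * (K j * Q) - K j * X) = 0 := by
    have h4 : ∀ j, (X * (K j * Q) - K j * X)ᴴ * (X * (K j * Q) - K j * X) =
        Q * ((K j)ᴴ * (Xᴴ * X) * K j) * Q - Q * ((K j)ᴴ * Xᴴ * K j) * X -
          Xᴴ * ((K j)ᴴ * X * K j) * Q + Xᴴ * ((K j)ᴴ * K j) * X := by
      intro j
      simp only [Matrix.conjTranspose_sub, Matrix.conjTranspose_mul, hQ, mul_sub, sub_mul,
        mul_assoc]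
      abel
    rw [Finset.sum_congr rfl fun j _ => h4 j, Finset.sum_add_distrib, Finset.sum_sub_distrib,
      Finset.sum_sub_distrib]
    simp only [← Finset.sum_mul, ← Finset.mul_sum]
    rw [h3, h2', h1', hK, mul_one, sub_self, zero_sub, neg_add_cancel]
  exact sub_eq_zero.mp (eq_zero_of_sum_conjTranspose_mul_self key i)

namespace Code

open ExtendedSubgroup

variable {n e s r k : ℕ} {C : Code n e s r k}

/-- If errors are correctable, then the compression of `E† F` to the code space commutes with the
encoded observables, for any two errors `E` and `F`. -/
lemma compression_comm_of_correctable {Err : Set (Pauli (Fin n))} (h : C.Correctable Err)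
    {Ea Eb : Pauli (Fin n)} (ha : Ea ∈ Err) (hb : Eb ∈ Err) {X : Op (Fin n ⊕ Fin e)}
    (hX : X ∈ C.sectorObservables) :
    C.Q * (Pauli.inl (Fin n) (Fin e) (Ea⁻¹ * Eb)).op * X =
      X * (Pauli.inl (Fin n) (Fin e) (Ea⁻¹ * Eb)).op * C.Q := by
  obtain ⟨p, R, hR, hrec⟩ := h
  have hsum : ∀ E : Pauli (Fin n),
      ∑ i, (R i * (Pauli.inl (Fin n) (Fin e) E).op)ᴴ * (R i * (Pauli.inl (Fin n) (Fin e) E).op) =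
        1 := by
    intro E
    simp only [Matrix.conjTranspose_mul, mul_assoc]
    rw [← Finset.mul_sum]
    simp only [← mul_assoc _ᴴ (R _) _]
    rw [← Finset.sum_mul, hR, one_mul]
    exact (Pauli.inl (Fin n) (Fin e) E).op_inv_mul_op
  -- the channel that applies a single error with certainty
  have hpres : ∀ E ∈ Err, ∀ Y ∈ C.sectorObservables,
      C.Q * (∑ i, (R i * (Pauli.inl (Fin n) (Fin e) E).op)ᴴ * Y *
        (R i * (Pauli.inl (Fin n) (Fin e) E).op)) * C.Q = Y := by
    intro E hE Y hY
    have h1 := hrec 1 (fun _ => (Pauli.inl (Fin n) (Fin e) E).op)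
      (by
        rw [IsChannel, Fin.sum_univ_one]
        exact (Pauli.inl (Fin n) (Fin e) E).op_inv_mul_op)
      (fun _ => ⟨_, ⟨E, hE, rfl⟩, 1, (one_smul _ _).symm⟩) Y (Submodule.subset_span hY)
    change C.Q * _ * C.Q = C.Q * Y * C.Q at h1
    rw [Q_mul_of_mem_sectorObservables hY, mul_Q_of_mem_sectorObservables hY] at h1
    have h2 : dualChannel (fun _ : Fin 1 => (Pauli.inl (Fin n) (Fin e) E).op) (dualChannel R Y) =
        ∑ i, (R i * (Pauli.inl (Fin n) (Fin e) E).op)ᴴ * Y *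
          (R i * (Pauli.inl (Fin n) (Fin e) E).op) := by
      rw [dualChannel, Fin.sum_univ_one, dualChannel, Finset.mul_sum, Finset.sum_mul]
      exact Finset.sum_congr rfl fun i _ => by simp only [Matrix.conjTranspose_mul, mul_assoc]
    rwa [← h2]
  have hcomm : ∀ E ∈ Err, ∀ Y ∈ C.sectorObservables, ∀ i,
      Y * (R i * (Pauli.inl (Fin n) (Fin e) E).op * C.Q) =
        R i * (Pauli.inl (Fin n) (Fin e) E).op * Y := fun E hE Y hY =>
    comm_kraus_of_preserves (hsum E) Q_conjTranspose (Q_mul_of_mem_sectorObservables hY)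
      (hpres E hE Y hY)
      (hpres E hE _ (star_mem_sectorObservables hY))
      (hpres E hE _ (star_mul_self_mem_sectorObservables hY))
  have hEE : (Pauli.inl (Fin n) (Fin e) (Ea⁻¹ * Eb)).op =
      ∑ i, (R i * (Pauli.inl (Fin n) (Fin e) Ea).op)ᴴ *
        (R i * (Pauli.inl (Fin n) (Fin e) Eb).op) := by
    simp only [Matrix.conjTranspose_mul, mul_assoc]
    rw [← Finset.mul_sum]
    simp only [← mul_assoc _ᴴ (R _) _]
    rw [← Finset.sum_mul, hR, one_mul, map_mul, map_inv]
    rfl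
  rw [hEE, Finset.mul_sum, Finset.sum_mul, Finset.mul_sum, Finset.sum_mul]
  refine Finset.sum_congr rfl fun i _ => ?_
  have h1 := hcomm Eb hb X hX i
  have h2 := congrArg Matrix.conjTranspose (hcomm Ea ha _ (star_mem_sectorObservables hX) i)
  rw [Matrix.conjTranspose_mul, Matrix.conjTranspose_conjTranspose, Matrix.conjTranspose_mul _ C.Q,
    Q_conjTranspose, Matrix.conjTranspose_mul _ Xᴴ, Matrix.conjTranspose_conjTranspose] at h2
  rw [mul_assoc, mul_assoc, ← h1, ← mul_assoc, ← mul_assoc, h2]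
  simp only [mul_assoc]

/-- Correctable errors do not lead from one sector of the code space to another. -/
lemma not_mem_of_correctable {Err : Set (Pauli (Fin n))} (h : C.Correctable Err)
    {Ea Eb : Pauli (Fin n)} (ha : Ea ∈ Err) (hb : Eb ∈ Err) {T T' : Pauli (Fin n ⊕ Fin e)}
    (hT : T ∈ C.T₀) (hT' : T' ∈ C.T₀) (hne : T ≠ T') :
    T⁻¹ * Pauli.inl (Fin n) (Fin e) (Ea⁻¹ * Eb) * T' ∉ C.NS := by
  intro hmem
  have h1 := compression_comm_of_correctable h ha hb
    (X := T.op * C.P * (T.op)ᴴ) ⟨T, hT, C.P, P_mem, rfl⟩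
  set g := Pauli.inl (Fin n) (Fin e) (Ea⁻¹ * Eb) with hg
  have h2 : (T.op)ᴴ * (T'.op * C.P) = (T⁻¹ * T').op * C.P := by
    rw [← mul_assoc]; rfl
  have h3 := congrArg (fun M => C.P * (T⁻¹).op * M * (T'.op * C.P)) h1
  -- the left side vanishes by orthogonality of the sectors, the right side does not
  have h4 : C.P * (T⁻¹).op * (C.Q * g.op * (T.op * C.P * (T.op)ᴴ)) * (T'.op * C.P) = 0 := by
    have h5 := P_mul_inv_mul_P hT hT' hne
    calc _ = C.P * (T⁻¹).op * (C.Q * g.op * T.op) * (C.P * (T⁻¹).op * (T'.op * C.P)) := by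
          simp only [mul_assoc, Pauli.op_inv]
      _ = 0 := by rw [h5, mul_zero]
  have h6 : C.P * (T⁻¹).op * (T.op * C.P * (T.op)ᴴ * g.op * C.Q) * (T'.op * C.P) =
      (T⁻¹ * g * T').op * C.P := by
    calc _ = C.P * ((T⁻¹).op * T.op) * C.P * ((T⁻¹).op * g.op) * (C.Q * (T'.op * C.P)) := by
          simp only [mul_assoc, Pauli.op_inv]
      _ = C.P * (T⁻¹ * g * T').op * C.P := by
          rw [Q_mul_sector hT', Pauli.op_inv_mul_op, mul_one, P_mul_self, Pauli.op_mul,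
            Pauli.op_mul]
          simp only [mul_assoc]
      _ = _ := by rw [P_comm_op hmem, mul_assoc, P_mul_self]
  rw [h4, h6] at h3
  exact op_mul_P_ne_zero _ h3.symm

/-- Correctable errors that preserve the base code space act on it by gauge operators. -/
lemma mem_gaugeGroup_of_correctable {Err : Set (Pauli (Fin n))} (h : C.Correctable Err)
    {Ea Eb : Pauli (Fin n)} (ha : Ea ∈ Err) (hb : Eb ∈ Err)
    (hmem : Pauli.inl (Fin n) (Fin e) (Ea⁻¹ * Eb) ∈ C.NS) :
    Pauli.inl (Fin n) (Fin e) (Ea⁻¹ * Eb) ∈ C.gaugeGroup := by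
  refine mem_gaugeGroup_of_commute hmem fun l hl => ?_
  have hlP : l.op * C.P ∈ compressionAlgebra C.P C.L₀ :=
    op_mul_P_mem (Subgroup.subset_closure hl)
  have h1 := compression_comm_of_correctable h ha hb (X := l.op * C.P)
    ⟨1, C.one_mem_T₀, _, hlP, by simp [Pauli.op_one]⟩
  set g := Pauli.inl (Fin n) (Fin e) (Ea⁻¹ * Eb) with hg
  have h2 := congrArg (fun M => C.P * M * C.P) h1
  have h3 : C.P * (C.Q * g.op * (l.op * C.P)) * C.P = (g * l).op * C.P := by
    calc _ = C.P * C.Q * (g.op * l.op) * (C.P * C.P) := by simp only [mul_assoc]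
      _ = _ := by
        rw [P_mul_Q, P_mul_self, ← Pauli.op_mul, P_comm_op (mul_mem hmem (L₀_subset_NS hl)),
          mul_assoc, P_mul_self]
  have h4 : C.P * (l.op * C.P * g.op * C.Q) * C.P = (l * g).op * C.P := by
    calc _ = C.P * l.op * (C.P * g.op) * (C.Q * C.P) := by simp only [mul_assoc]
      _ = C.P * (l * g).op * C.P := by
        rw [Q_mul_P, P_comm_op hmem, Pauli.op_mul]
        simp only [mul_assoc]
        rw [P_mul_self]
      _ = _ := by rw [P_comm_op (mul_mem (L₀_subset_NS hl) hmem), mul_assoc, P_mul_self]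
  rw [h3, h4] at h2
  refine (Pauli.commute_or_anticommute g l).resolve_right fun h5 => ?_
  rw [h5, Pauli.op_negOne_mul, neg_mul] at h2
  exact op_mul_P_ne_zero (l * g)
    (Matrix.ext fun i j => neg_eq_self.mp (congrFun (congrFun h2 i) j))

/-! ### Syndrome measurement -/

/-- The projection onto the subspace `g C(S)`, which depends on the coset `g N(S)` only. -/
noncomputable def syndrome (C : Code n e s r k) (c : Pauli (Fin n ⊕ Fin e) ⧸ C.NS) :
    Op (Fin n ⊕ Fin e) :=
  c.out.op * C.P * (c.out⁻¹).op

lemma syndrome_mk (g : Pauli (Fin n ⊕ Fin e)) :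
    C.syndrome (QuotientGroup.mk g) = g.op * C.P * (g⁻¹).op := by
  obtain ⟨z, hz⟩ := QuotientGroup.mk_out_eq_mul C.NS g
  have h1 := P_comm_op z.2
  rw [syndrome, hz, mul_inv_rev, Pauli.op_mul, Pauli.op_mul]
  calc _ = g.op * ((z : Pauli (Fin n ⊕ Fin e)).op * C.P) *
        ((z : Pauli (Fin n ⊕ Fin e))⁻¹).op * (g⁻¹).op := by simp only [mul_assoc]
    _ = _ := by
      rw [← h1, mul_assoc, mul_assoc, mul_assoc, ← mul_assoc (z : Pauli (Fin n ⊕ Fin e)).op,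
        Pauli.op_mul_op_inv, one_mul, mul_assoc]

lemma syndrome_conjTranspose (c : Pauli (Fin n ⊕ Fin e) ⧸ C.NS) :
    (C.syndrome c)ᴴ = C.syndrome c := by
  rw [syndrome, Matrix.conjTranspose_mul, Matrix.conjTranspose_mul, P_conjTranspose,
    ← Pauli.op_inv, ← Pauli.op_inv, inv_inv, mul_assoc]

lemma syndrome_mul_self (c : Pauli (Fin n ⊕ Fin e) ⧸ C.NS) :
    C.syndrome c * C.syndrome c = C.syndrome c := by
  calc _ = c.out.op * (C.P * ((c.out⁻¹).op * c.out.op) * C.P) * (c.out⁻¹).op := by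
        simp only [syndrome, mul_assoc]
    _ = _ := by rw [Pauli.op_inv_mul_op, mul_one, P_mul_self, syndrome]

lemma syndrome_mk_mul_self (g : Pauli (Fin n ⊕ Fin e)) :
    C.syndrome (QuotientGroup.mk g) * (g.op * C.P) = g.op * C.P := by
  calc _ = g.op * (C.P * ((g⁻¹).op * g.op) * C.P) := by
        simp only [syndrome_mk, mul_assoc]
    _ = _ := by rw [Pauli.op_inv_mul_op, mul_one, P_mul_self]

lemma syndrome_mul_of_ne {c : Pauli (Fin n ⊕ Fin e) ⧸ C.NS} {g : Pauli (Fin n ⊕ Fin e)}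
    (h : c ≠ QuotientGroup.mk g) : C.syndrome c * (g.op * C.P) = 0 := by
  induction c using QuotientGroup.induction_on with | _ a
  calc _ = a.op * (C.P * (a⁻¹ * g).op * C.P) := by
        simp only [syndrome_mk, Pauli.op_mul, mul_assoc]
    _ = 0 := by
        rw [P_mul_op_mul_P fun H => h (QuotientGroup.eq.mpr H), mul_zero]

/-- The syndrome projections sum to the identity: the sum commutes with all Pauli operators, so it
is a scalar, and it acts as the identity on the base code space. -/
lemma sum_syndrome [Fintype (Pauli (Fin n ⊕ Fin e) ⧸ C.NS)] : ∑ c, C.syndrome c = 1 := by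
  have hcomm : ∀ h : Pauli (Fin n ⊕ Fin e),
      h.op * (∑ c, C.syndrome c) = (∑ c, C.syndrome c) * h.op := by
    intro h
    rw [Finset.mul_sum, Finset.sum_mul]
    let := MulAction.quotient (Pauli (Fin n ⊕ Fin e)) C.NS
    refine Fintype.sum_equiv (MulAction.toPerm h) _ _ fun c => ?_
    induction c using QuotientGroup.induction_on with | _ a
    rw [MulAction.toPerm_apply, MulAction.Quotient.smul_mk, syndrome_mk, syndrome_mk, smul_eq_mul,
      mul_inv_rev, Pauli.op_mul, Pauli.op_mul]
    calc _ = h.op * (a.op * C.P * (a⁻¹).op) * ((h⁻¹).op * h.op) := by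
          rw [Pauli.op_inv_mul_op, mul_one]
      _ = _ := by simp only [mul_assoc]
  obtain ⟨c, hc⟩ := exists_eq_smul_one_of_comm (∑ c, C.syndrome c)
    (fun j => hcomm (Pauli.X j)) fun j => hcomm (Pauli.Z j)
  have h1 : (∑ c, C.syndrome c) * C.P = C.P := by
    rw [Finset.sum_mul, Finset.sum_eq_single (QuotientGroup.mk (1 : Pauli (Fin n ⊕ Fin e)))]
    · simpa [Pauli.op_one] using syndrome_mk_mul_self (C := C) 1
    · intro b _ hb
      simpa [Pauli.op_one] using syndrome_mul_of_ne hb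
    · simp
  rw [hc, Matrix.smul_mul, one_mul] at h1
  have h2 : c = 1 := by
    have h3 : (c - 1) • C.P = 0 := by rw [sub_smul, h1, one_smul, sub_self]
    exact sub_eq_zero.mp ((smul_eq_zero.mp h3).resolve_right P_ne_zero)
  rw [hc, h2, one_smul]

/-! ### Sufficiency of the condition -/

open Classical in
/-- An error compatible with a syndrome: one that leads from some sector to the syndrome space,
if there is such an error, and the identity otherwise. -/
noncomputable def syndromeError (C : Code n e s r k) (Err : Set (Pauli (Fin n)))
    (c : Pauli (Fin n ⊕ Fin e) ⧸ C.NS) : Pauli (Fin n) :=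
  if h : ∃ E ∈ Err, ∃ T ∈ C.T₀, c = QuotientGroup.mk (Pauli.inl (Fin n) (Fin e) E * T) then
    h.choose else 1

lemma syndromeError_spec {Err : Set (Pauli (Fin n))} {E : Pauli (Fin n)} (hE : E ∈ Err)
    {T : Pauli (Fin n ⊕ Fin e)} (hT : T ∈ C.T₀) :
    ∃ F ∈ Err, C.syndromeError Err (QuotientGroup.mk (Pauli.inl (Fin n) (Fin e) E * T)) = F ∧
      ∃ T' ∈ C.T₀, T'⁻¹ * Pauli.inl (Fin n) (Fin e) (F⁻¹ * E) * T ∈ C.NS := by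
  have h : ∃ E' ∈ Err, ∃ T' ∈ C.T₀,
      (QuotientGroup.mk (Pauli.inl (Fin n) (Fin e) E * T) : Pauli (Fin n ⊕ Fin e) ⧸ C.NS) =
        QuotientGroup.mk (Pauli.inl (Fin n) (Fin e) E' * T') := ⟨E, hE, T, hT, rfl⟩
  obtain ⟨h1, T', hT', h2⟩ := h.choose_spec
  refine ⟨h.choose, h1, dif_pos h, T', hT', ?_⟩
  have h3 := QuotientGroup.eq.mp h2.symm
  have h4 : ∀ F : Pauli (Fin n), (Pauli.inl (Fin n) (Fin e) F * T')⁻¹ *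
      (Pauli.inl (Fin n) (Fin e) E * T) =
        T'⁻¹ * Pauli.inl (Fin n) (Fin e) (F⁻¹ * E) * T := fun F => by
    rw [map_mul, map_inv]; group
  rwa [h4] at h3

/-- The operators `F† Π`, which undo an error compatible with the measured syndrome. -/
noncomputable def recoveryOp (C : Code n e s r k) (Err : Set (Pauli (Fin n)))
    (c : Pauli (Fin n ⊕ Fin e) ⧸ C.NS) : Op (Fin n ⊕ Fin e) :=
  ((Pauli.inl (Fin n) (Fin e) (C.syndromeError Err c))⁻¹).op * C.syndrome c

lemma recoveryOp_conjTranspose (Err : Set (Pauli (Fin n)))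
    (c : Pauli (Fin n ⊕ Fin e) ⧸ C.NS) :
    (C.recoveryOp Err c)ᴴ =
      C.syndrome c * (Pauli.inl (Fin n) (Fin e) (C.syndromeError Err c)).op := by
  rw [recoveryOp, Matrix.conjTranspose_mul, syndrome_conjTranspose, ← Pauli.op_inv, inv_inv]

lemma sum_recoveryOp [Fintype (Pauli (Fin n ⊕ Fin e) ⧸ C.NS)] (Err : Set (Pauli (Fin n))) :
    ∑ c, (C.recoveryOp Err c)ᴴ * C.recoveryOp Err c = 1 := by
  rw [← sum_syndrome (C := C)]
  refine Finset.sum_congr rfl fun c _ => ?_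
  rw [recoveryOp_conjTranspose, recoveryOp, mul_assoc, ← mul_assoc (Pauli.op _),
    Pauli.op_mul_op_inv, one_mul, syndrome_mul_self]

/-- The recovery restores the observables of all sectors after each error, provided errors with
the same syndrome differ by gauge operators. -/
lemma recovery_mul_sector [Fintype (Pauli (Fin n ⊕ Fin e) ⧸ C.NS)] {Err : Set (Pauli (Fin n))}
    (hgauge : ∀ Ea ∈ Err, ∀ Eb ∈ Err, ∀ T ∈ C.T₀, ∀ T' ∈ C.T₀,
      T⁻¹ * Pauli.inl (Fin n) (Fin e) (Ea⁻¹ * Eb) * T' ∈ C.NS →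
        Pauli.inl (Fin n) (Fin e) (Ea⁻¹ * Eb) ∈ C.gaugeGroup)
    {E : Pauli (Fin n)} (hE : E ∈ Err) {T : Pauli (Fin n ⊕ Fin e)} (hT : T ∈ C.T₀)
    {X : Op (Fin n ⊕ Fin e)} (hX : X ∈ C.sectorObservables) :
    (∑ c, (C.recoveryOp Err c)ᴴ * X * C.recoveryOp Err c) *
      ((Pauli.inl (Fin n) (Fin e) E).op * (T.op * C.P)) =
        (Pauli.inl (Fin n) (Fin e) E).op * (X * (T.op * C.P)) := by
  set ι := Pauli.inl (Fin n) (Fin e) with hι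
  have hET : (ι E).op * (T.op * C.P) = (ι E * T).op * C.P := by
    rw [Pauli.op_mul, mul_assoc]
  rw [Finset.sum_mul, Finset.sum_eq_single (QuotientGroup.mk (ι E * T))]
  · obtain ⟨F, hF, hF', T', hT', hNS⟩ := syndromeError_spec (C := C) hE hT
    have hγ := hgauge F hF E hE T' hT' T hT hNS
    obtain ⟨Y, hY⟩ := exists_mul_sector hT hX
    have h1 : ((ι F)⁻¹).op * (ι E).op = (ι (F⁻¹ * E)).op := by
      rw [map_mul, map_inv, Pauli.op_mul]
    have h2 : (ι F).op * (ι (F⁻¹ * E)).op = (ι E).op := by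
      rw [← Pauli.op_mul, ← map_mul, mul_inv_cancel_left]
    rw [recoveryOp_conjTranspose, recoveryOp, ← hι, hF', hET]
    calc _ = C.syndrome (QuotientGroup.mk (ι E * T)) * (ι F).op * X * ((ι F)⁻¹).op *
          (C.syndrome (QuotientGroup.mk (ι E * T)) * ((ι E * T).op * C.P)) := by
          simp only [mul_assoc]
      _ = C.syndrome (QuotientGroup.mk (ι E * T)) * (ι F).op *
          (X * (((ι F)⁻¹).op * (ι E).op)) * (T.op * C.P) := by
          rw [syndrome_mk_mul_self, ← hET]
          simp only [mul_assoc]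
      _ = C.syndrome (QuotientGroup.mk (ι E * T)) * ((ι F).op * (ι (F⁻¹ * E)).op) *
          (X * (T.op * C.P)) := by
          rw [h1, ← gaugeGroup_commute_sectorObservables hγ hX]
          simp only [mul_assoc]
      _ = C.syndrome (QuotientGroup.mk (ι E * T)) * ((ι E).op * (T.op * C.P)) * Y := by
          rw [h2, hY]
          simp only [mul_assoc]
      _ = _ := by
          rw [hET, syndrome_mk_mul_self, ← hET, hY, mul_assoc]
  · intro c _ hc
    rw [mul_assoc, hET, recoveryOp, mul_assoc (Pauli.op _), syndrome_mul_of_ne hc, mul_zero,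
      mul_zero]
  · simp

/-- If errors with the same syndrome differ by gauge operators, then they are correctable. -/
lemma correctable_of_gauge {Err : Set (Pauli (Fin n))}
    (hgauge : ∀ Ea ∈ Err, ∀ Eb ∈ Err, ∀ T ∈ C.T₀, ∀ T' ∈ C.T₀,
      T⁻¹ * Pauli.inl (Fin n) (Fin e) (Ea⁻¹ * Eb) * T' ∈ C.NS →
        Pauli.inl (Fin n) (Fin e) (Ea⁻¹ * Eb) ∈ C.gaugeGroup) : C.Correctable Err := by
  have := Fintype.ofFinite (Pauli (Fin n ⊕ Fin e) ⧸ C.NS)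
  let ε := Fintype.equivFin (Pauli (Fin n ⊕ Fin e) ⧸ C.NS)
  have hdual : ∀ X, dualChannel (fun i => C.recoveryOp Err (ε.symm i)) X =
      ∑ c, (C.recoveryOp Err c)ᴴ * X * C.recoveryOp Err c := fun X =>
    ε.symm.sum_comp fun c => (C.recoveryOp Err c)ᴴ * X * C.recoveryOp Err c
  refine ⟨_, fun i => C.recoveryOp Err (ε.symm i), ?_, ?_⟩
  · exact (ε.symm.sum_comp fun c => (C.recoveryOp Err c)ᴴ * C.recoveryOp Err c).trans
      (sum_recoveryOp Err)
  intro q N hN hErr X hX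
  have key : dualChannel N (dualChannel (fun i => C.recoveryOp Err (ε.symm i)) X) * C.Q =
      X * C.Q := by
    rw [hdual]
    refine mul_Q_ext fun T hT => ?_
    have hsector : ∀ E ∈ Err, (∑ c, (C.recoveryOp Err c)ᴴ * X * C.recoveryOp Err c) *
        ((Pauli.inl (Fin n) (Fin e) E).op * (T.op * C.P)) =
          (Pauli.inl (Fin n) (Fin e) E).op * (X * (T.op * C.P)) := by
      intro E hE
      change X ∈ C.logicalAlgebra at hX
      rw [logicalAlgebra_eq] at hX
      induction hX using Submodule.span_induction with
      | mem X hX => exact recovery_mul_sector hgauge hE hT hX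
      | zero => simp
      | add X Y _ _ h1 h2 =>
        simp only [mul_add, add_mul, Finset.sum_add_distrib, h1, h2]
      | smul a X _ h =>
        simp only [Matrix.mul_smul, Matrix.smul_mul, ← Finset.smul_sum, h]
    have hterm : ∀ a, (N a)ᴴ * (∑ c, (C.recoveryOp Err c)ᴴ * X * C.recoveryOp Err c) * N a *
        (T.op * C.P) = (N a)ᴴ * N a * (X * (T.op * C.P)) := by
      intro a
      obtain ⟨_, ⟨E, hE, rfl⟩, z, hz⟩ := hErr a
      have h1 : N a = z • (Pauli.inl (Fin n) (Fin e) E).op := hz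
      rw [mul_assoc, mul_assoc, mul_assoc]
      congr 1
      rw [h1, Matrix.smul_mul, Matrix.mul_smul, hsector E hE, Matrix.smul_mul]
    rw [dualChannel, Finset.sum_mul, Finset.sum_congr rfl fun a _ => hterm a, ← Finset.sum_mul,
      hN, one_mul]
  change C.Q * _ * C.Q = C.Q * X * C.Q
  rw [mul_assoc, key, mul_assoc]

/-! ### Translation to Alice's qubits -/

/-- For operators on Alice's qubits, `g` leads from the sector `t'` to the sector `t` iff it lies
in `t t'⁻¹ Z(H)`. -/
lemma mem_sector_coset_iff {t t' g : Pauli (Fin n)} :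
    (Pauli.inl (Fin n) (Fin e) t)⁻¹ * Pauli.inl (Fin n) (Fin e) g *
        Pauli.inl (Fin n) (Fin e) t' ∈ C.NS ↔
      g ∈ (fun z => t * t'⁻¹ * z) '' (Subgroup.centralizer (C.H : Set (Pauli (Fin n))) :
        Set (Pauli (Fin n))) := by
  rw [← map_inv, ← map_mul, ← map_mul, inl_mem_NS_iff]
  have hn : (Subgroup.centralizer (C.H : Set (Pauli (Fin n)))).Normal :=
    normal_of_negOne_mem (Subgroup.mem_centralizer_iff.mpr fun h _ =>
      (Pauli.negOne_comm h).symm)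
  constructor
  · intro h
    refine ⟨_, hn.conj_mem _ h t', ?_⟩
    simp only
    group
  · rintro ⟨z, hz, rfl⟩
    have h1 := hn.conj_mem z hz t'⁻¹
    rw [inv_inv] at h1
    have h2 : t⁻¹ * (t * t'⁻¹ * z) * t' = t'⁻¹ * z * t' := by group
    rwa [h2]

end Code
end EAOAQEC

open EAOAQEC Code ExtendedSubgroup in
theorem mainTheorem1 {n e s r k : ℕ} (C : EAOAQEC.Code n e s r k)
    (hT : ∀ T ∈ C.T₀, ∃ t : EAOAQEC.Pauli (Fin n), T = EAOAQEC.Pauli.tensor (t, 1))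
    (Err : Set (EAOAQEC.Pauli (Fin n))) :
    C.Correctable Err ↔
      ∀ Ea ∈ Err, ∀ Eb ∈ Err,
        Ea⁻¹ * Eb ∈
          ((Subgroup.closure ((C.HI : Set (EAOAQEC.Pauli (Fin n))) ∪ EAOAQEC.Code.alice C.G₀ ∪
                {EAOAQEC.Pauli.iI (Fin n)}) : Set (EAOAQEC.Pauli (Fin n))) ∪
              (Set.univ \ (Subgroup.centralizer (C.H : Set (EAOAQEC.Pauli (Fin n))) :
                Set (EAOAQEC.Pauli (Fin n))))) ∩
            (Set.univ \ ⋃ Ti ∈ EAOAQEC.Code.alice C.T₀, ⋃ Tj ∈ EAOAQEC.Code.alice C.T₀,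
              ⋃ (_ : Ti ≠ Tj),
                (fun z => Ti * Tj⁻¹ * z) '' (Subgroup.centralizer
                  (C.H : Set (EAOAQEC.Pauli (Fin n))) : Set (EAOAQEC.Pauli (Fin n)))) := by
  constructor
  · intro h Ea ha Eb hb
    refine ⟨?_, Set.mem_univ _, ?_⟩
    · by_cases hz : Ea⁻¹ * Eb ∈ Subgroup.centralizer (C.H : Set (Pauli (Fin n)))
      · exact .inl (mem_aliceGaugeGroup
          (mem_gaugeGroup_of_correctable h ha hb (inl_mem_NS_iff.mpr hz)))
      · exact .inr ⟨Set.mem_univ _, hz⟩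
    · simp only [Set.mem_iUnion, not_exists]
      intro t ht t' ht' hne hmem
      exact not_mem_of_correctable h ha hb ht ht' (fun H => hne (Pauli.inl_injective H))
        (mem_sector_coset_iff.mpr hmem)
  · intro h
    refine correctable_of_gauge fun Ea ha Eb hb T hT1 T' hT2 hmem => ?_
    obtain ⟨t, rfl⟩ := hT T hT1
    obtain ⟨t', rfl⟩ := hT T' hT2
    obtain ⟨h1, -, h2⟩ := h Ea ha Eb hb
    have hcoset := mem_sector_coset_iff.mp hmem
    have htt : t = t' := by
      by_contra hne
      refine h2 ?_
      simp only [Set.mem_iUnion]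
      exact ⟨t, hT1, t', hT2, hne, hcoset⟩
    subst htt
    obtain ⟨z, hz, hz'⟩ := hcoset
    simp only [mul_inv_cancel, one_mul] at hz'
    refine inl_mem_gaugeGroup (h1.resolve_right fun h3 => h3.2 ?_)
    rw [← hz']
    exact hz
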